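/- Let $\delta$ be an analytic Jordan curve, that is, $\delta(t)=\Phi(e^{it})$ for $t\in\mathbb R$, where $\Phi$ is holomorphic and injective on an annulus $\{r<|z|<R\}$ with $0<r<1<R$. Let $\Omega$ be the interior of $\delta$ (the bounded component of the complement of its trace), and let $\varphi:D\to\Omega$ be a Riemann map (a holomorphic bijection) of the open unit disk $D$ onto $\Omega$. Denote by $\varphi(e^{i\theta})$ the boundary values of $\varphi$ (limits from $D$), put $\gamma(\theta)=\varphi(e^{i\theta})$ and $\gamma^*=\{\gamma(\theta):\theta\in\mathbb R\}=\partial\Omega$, and let $A$ and $B$ be the bounded and the unbounded component of $\mathbb C\setminus\gamma^*$. For $k\in\{0,1,2,\dots\}\cup\{\infty\}$ let $C^k(\gamma^*)=C^k(\partial\Omega)$ be the space of continuous functions $u:\gamma^*\to\mathbb C$ for which $\theta\mapsto u(\varphi(e^{i\theta}))$ is $k$ times continuously differentiable (infinitely differentiable if $k=\infty$) on $\mathbb R$, with the topology defined by the seminorms $$\sup_{\theta\in\mathbb R}\left|\frac{d^l}{d\theta^l}\,u(\varphi(e^{i\theta}))\right|,\qquad l\in\{0,1,2,\dots\},\ l\le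 k.$$ For an open set $S\subseteq\mathbb C\setminus\gamma^*$ and $z_0\in\gamma^*$, say that $u$ extends to $S$ near $z_0$ if there are $r>0$ and a continuous function $\lambda:\gamma^*\cup(D(z_0,r)\cap S)\to\mathbb C$ which is holomorphic on $D(z_0,r)\cap S$ and satisfies $\lambda=u$ on $D(z_0,r)\cap\gamma^*$. Here $D(z_0,r)$ is the open disk of centre $z_0$ and radius $r$. Define - $U_2(\gamma^*,k)$: the set of $u\in C^k(\gamma^*)$ that do not extend to $B$ near any $z_0\in\gamma^*$; - $U_3(\gamma^*,k)$: the set of $u\in C^k(\gamma^*)$ that do not extend to $A$ near any $z_0\in\gamma^*$; - $U_4(\gamma^*,k)$: the set of $u\in C^k(\gamma^*)$ that extend neither to $B$ near any $z_0\in\gamma^*$ nor to $A$ near any $z_0\in\gamma^*$. **Theorem 4.27.** For every $k=0,1,2,\dots,\infty$, each of the classes $U_2(\gamma^*,k)$, $U_3(\gamma^*,k)$, $U_4(\gamma^*,k)$ is a dense $G_\delta$ subset of $C^k(\gamma^*)$. -/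

import Mathlib

open Set Metric Filter Topology

namespace JordanCurve

/-- `δ` is an analytic Jordan curve: `δ t = Φ (e^{it})` for a function `Φ` which is holomorphic and
injective on an annulus `r < |z| < R` with `0 < r < 1 < R`. -/
def IsAnalytic (δ : ℝ → ℂ) : Prop :=
  ∃ (r R : ℝ) (Φ : ℂ → ℂ), 0 < r ∧ r < 1 ∧ 1 < R ∧
    DifferentiableOn ℂ Φ {z : ℂ | r < ‖z‖ ∧ ‖z‖ < R} ∧
    InjOn Φ {z : ℂ | r < ‖z‖ ∧ ‖z‖ < R} ∧
    ∀ t : ℝ, δ t = Φ (Complex.exp (t * Complex.I))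

/-- The points off `K` whose connected component in `ℂ \ K` is bounded: for the trace `K` of a
Jordan curve this is the bounded component of the complement (the interior of the curve). -/
def boundedSide (K : Set ℂ) : Set ℂ :=
  {z | z ∈ Kᶜ ∧ Bornology.IsBounded (connectedComponentIn Kᶜ z)}

/-- The points off `K` whose connected component in `ℂ \ K` is unbounded: for the trace `K` of a
Jordan curve this is the unbounded component of the complement (the exterior of the curve). -/
def unboundedSide (K : Set ℂ) : Set ℂ :=
  {z | z ∈ Kᶜ ∧ ¬ Bornology.IsBounded (connectedComponentIn Kᶜ z)}

/-- `φ` is a Riemann map of the open unit disk onto `Ω`: holomorphic and bijective. Only the values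
of `φ` on the open disk matter. -/
def IsRiemannMap (φ : ℂ → ℂ) (Ω : Set ℂ) : Prop :=
  DifferentiableOn ℂ φ (ball 0 1) ∧ BijOn φ (ball 0 1) Ω

/-- The curve `γ θ = φ (e^{iθ})`, where the value of `φ` at a point of the unit circle is its
limit from the open unit disk. -/
noncomputable def boundaryCurve (φ : ℂ → ℂ) (θ : ℝ) : ℂ :=
  extendFrom (ball (0 : ℂ) 1) φ (Complex.exp (θ * Complex.I))

/-- The trace `γ*` of the curve `γ θ = φ (e^{iθ})`. -/
def trace (φ : ℂ → ℂ) : Set ℂ := range (boundaryCurve φ)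

/-- The function `θ ↦ u (φ (e^{iθ}))`, for `u` defined on `γ*`. -/
noncomputable def pullback (φ : ℂ → ℂ) (u : trace φ → ℂ) (θ : ℝ) : ℂ :=
  u ⟨boundaryCurve φ θ, mem_range_self θ⟩

theorem pullback_add (φ : ℂ → ℂ) (u v : trace φ → ℂ) :
    pullback φ (u + v) = pullback φ u + pullback φ v := rfl

theorem pullback_smul (φ : ℂ → ℂ) (c : ℂ) (u : trace φ → ℂ) :
    pullback φ (c • u) = c • pullback φ u := rfl

theorem pullback_periodic (φ : ℂ → ℂ) (u : trace φ → ℂ) :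
    Function.Periodic (pullback φ u) (2 * Real.pi) := by
  intro θ
  have h : boundaryCurve φ (θ + 2 * Real.pi) = boundaryCurve φ θ := by
    unfold boundaryCurve
    congr 1
    push_cast
    rw [add_mul]
    exact Complex.exp_periodic _
  exact congrArg u (Subtype.ext h)

/-- The functions `u : γ* → ℂ` of class `C^k`, `k = 0, 1, …, ∞`, as a vector space: `u` is
continuous and `θ ↦ u (φ (e^{iθ}))` is `k` times continuously differentiable. -/
def ckSubmodule (φ : ℂ → ℂ) (k : ℕ∞) : Submodule ℂ (trace φ → ℂ) where
  carrier := {u | Continuous u ∧ ContDiff ℝ k (pullback φ u)}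
  add_mem' hu hv := ⟨hu.1.add hv.1, hu.2.add hv.2⟩
  zero_mem' := ⟨continuous_const, contDiff_const⟩
  smul_mem' c _ hu := ⟨hu.1.const_smul c, hu.2.const_smul c⟩

/-- The space `C^k(γ*)`. This is a type synonym, so that it does not carry the topology of
pointwise convergence. -/
def Ck (φ : ℂ → ℂ) (k : ℕ∞) : Type := ↥(ckSubmodule φ k)

noncomputable instance (φ : ℂ → ℂ) (k : ℕ∞) : AddCommGroup (Ck φ k) :=
  inferInstanceAs (AddCommGroup ↥(ckSubmodule φ k))

noncomputable instance (φ : ℂ → ℂ) (k : ℕ∞) : Module ℂ (Ck φ k) :=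
  inferInstanceAs (Module ℂ ↥(ckSubmodule φ k))

/-- The function on `γ*` underlying an element of `C^k(γ*)`. -/
def Ck.toFun {φ : ℂ → ℂ} {k : ℕ∞} (u : Ck φ k) : trace φ → ℂ := Subtype.val u

theorem Ck.toFun_add {φ : ℂ → ℂ} {k : ℕ∞} (u v : Ck φ k) :
    (u + v).toFun = u.toFun + v.toFun := rfl

theorem Ck.toFun_smul {φ : ℂ → ℂ} {k : ℕ∞} (c : ℂ) (u : Ck φ k) :
    (c • u).toFun = c • u.toFun := rfl

theorem Ck.contDiff {φ : ℂ → ℂ} {k : ℕ∞} (u : Ck φ k) {l : ℕ} (hl : (l : ℕ∞) ≤ k) :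
    ContDiff ℝ l (pullback φ u.toFun) :=
  (Subtype.prop u).2.of_le (by exact_mod_cast hl)

theorem Ck.bddAbove {φ : ℂ → ℂ} {k : ℕ∞} (u : Ck φ k) {l : ℕ} (hl : (l : ℕ∞) ≤ k) :
    BddAbove (range fun θ : ℝ => ‖iteratedDeriv l (pullback φ u.toFun) θ‖) := by
  have hc : Continuous (iteratedDeriv l (pullback φ u.toFun)) :=
    (u.contDiff hl).continuous_iteratedDeriv l le_rfl
  have hp : Function.Periodic (iteratedDeriv l (pullback φ u.toFun)) (2 * Real.pi) := by
    intro θ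
    have h := congrFun (iteratedDeriv_comp_add_const l (pullback φ u.toFun) (2 * Real.pi)) θ
    rw [← h]
    congr 1
    funext t
    exact pullback_periodic φ u.toFun t
  have hp' : Function.Periodic (fun θ : ℝ => ‖iteratedDeriv l (pullback φ u.toFun) θ‖)
      (2 * Real.pi) := fun θ => by simp only [hp θ]
  exact (hp'.compact_of_continuous (by positivity) hc.norm).bddAbove

/-- The seminorms `sup_θ |d^l/dθ^l u (φ (e^{iθ}))|` of `C^k(γ*)`, for the finite `l ≤ k`. -/
noncomputable def ckSeminorm (φ : ℂ → ℂ) (k : ℕ∞) :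
    SeminormFamily ℂ (Ck φ k) {l : ℕ // (l : ℕ∞) ≤ k} := fun l =>
  Seminorm.of (fun u => ⨆ θ : ℝ, ‖iteratedDeriv l.1 (pullback φ u.toFun) θ‖)
    (by
      intro u v
      refine ciSup_le fun θ => ?_
      rw [Ck.toFun_add, pullback_add, iteratedDeriv_add (u.contDiff l.2).contDiffAt
        (v.contDiff l.2).contDiffAt]
      exact (norm_add_le _ _).trans (add_le_add (le_ciSup (u.bddAbove l.2) θ)
        (le_ciSup (v.bddAbove l.2) θ)))
    (by
      intro c u
      rw [Real.mul_iSup_of_nonneg (norm_nonneg c)]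
      refine iSup_congr fun θ => ?_
      rw [Ck.toFun_smul, pullback_smul, iteratedDeriv_const_smul (u.contDiff l.2).contDiffAt,
        norm_smul])

/-- The topology of `C^k(γ*)` is the one defined by these seminorms. -/
noncomputable instance (φ : ℂ → ℂ) (k : ℕ∞) : TopologicalSpace (Ck φ k) :=
  haveI : Nonempty {l : ℕ // (l : ℕ∞) ≤ k} := ⟨⟨0, by simp⟩⟩
  (ckSeminorm φ k).moduleFilterBasis.topology

/-- `u` extends holomorphically near `z₀` into the side `S` of `K`: for some `r > 0` there is a
function which is continuous on `K ∪ (D(z₀, r) ∩ S)`, holomorphic on `D(z₀, r) ∩ S`, and equal to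
`u` on `D(z₀, r) ∩ K`. -/
def ExtendsAt (K S : Set ℂ) (u : K → ℂ) (z₀ : ℂ) : Prop :=
  ∃ r : ℝ, 0 < r ∧ ∃ F : ℂ → ℂ,
    ContinuousOn F (K ∪ (ball z₀ r ∩ S)) ∧ DifferentiableOn ℂ F (ball z₀ r ∩ S) ∧
    ∀ z : K, (z : ℂ) ∈ ball z₀ r → F z = u z

/-- The class of `u ∈ C^k(γ*)` that do not extend into the unbounded component of `ℂ \ γ*`
near any point of `γ*`. -/
def U₂ (φ : ℂ → ℂ) (k : ℕ∞) : Set (Ck φ k) :=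
  {u | ¬ ∃ z₀ ∈ trace φ, ExtendsAt (trace φ) (unboundedSide (trace φ)) u.toFun z₀}

/-- The class of `u ∈ C^k(γ*)` that do not extend into the bounded component of `ℂ \ γ*`
near any point of `γ*`. -/
def U₃ (φ : ℂ → ℂ) (k : ℕ∞) : Set (Ck φ k) :=
  {u | ¬ ∃ z₀ ∈ trace φ, ExtendsAt (trace φ) (boundedSide (trace φ)) u.toFun z₀}

/-- The class of `u ∈ C^k(γ*)` that extend neither into the unbounded nor into the bounded
component of `ℂ \ γ*` near any point of `γ*`. -/
def U₄ (φ : ℂ → ℂ) (k : ℕ∞) : Set (Ck φ k) :=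
  {u | (¬ ∃ z₀ ∈ trace φ, ExtendsAt (trace φ) (unboundedSide (trace φ)) u.toFun z₀) ∧
    ¬ ∃ z₀ ∈ trace φ, ExtendsAt (trace φ) (boundedSide (trace φ)) u.toFun z₀}

end JordanCurve

/-
Read in the angle `w` of an annular chart `w ↦ Ψ (exp (i w))` around the curve, `u` extends to one
side near a point exactly when the function `v` which `u` becomes on the real axis extends to a half
disc. By the two-constants theorem, uniform convergence on the diameter of functions with extensions
bounded by one `M` forces uniform convergence of the extensions on a smaller half disc. The closure
in `C^k` of the functions which extend with bound `M` to a given half disc therefore lies in the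
*linear* space of functions which extend to the smaller one. This space is proper: a function
vanishing on part of the diameter has zero as its only possible extension, so a bump function has
none. A proper linear subspace has empty interior, rational centres and radii `1 / (n + 1)` and
integer bounds suffice, and `C^k` is completely metrizable, so Baire's theorem applies.

The bump function has to be smooth in the parameter `θ` of the boundary values of `φ`, for which
these must give a homeomorphism of the circle onto the curve. In an annular chart `φ` and its
inverse become maps between inner neighbourhoods of the unit circle, with `‖f z‖ → 1` as `‖z‖ → 1`.
The maximum principle gives `‖z‖ ^ m ≤ ‖f z‖` near the circle for some `m`; by the Schwarz–Pick
lemma the derivative of such an `f` is bounded there, so that its boundary limits exist.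
-/

namespace JordanCurve

section InjectiveHolomorphic

variable {f : ℂ → ℂ} {U : Set ℂ} {z : ℂ}

theorem not_eventually_eq_of_injOn (hU : U ∈ 𝓝 z) (hi : InjOn f U) :
    ¬ ∀ᶠ w in 𝓝 z, f w = f z := by
  intro hc
  obtain ⟨w, ⟨hw, hwU⟩, hne⟩ :=
    (((hc.and hU).filter_mono nhdsWithin_le_nhds).and self_mem_nhdsWithin :
      ∀ᶠ w in 𝓝[≠] z, (f w = f z ∧ w ∈ U) ∧ w ∈ ({z}ᶜ : Set ℂ)).exists
  exact hne (hi hwU (mem_of_mem_nhds hU) hw)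

theorem nhds_le_map_nhds_of_injOn (hU : IsOpen U) (hf : DifferentiableOn ℂ f U)
    (hi : InjOn f U) (hz : z ∈ U) : 𝓝 (f z) ≤ map f (𝓝 z) :=
  (hf.analyticAt (hU.mem_nhds hz)).eventually_constant_or_nhds_le_map_nhds.resolve_left
    (not_eventually_eq_of_injOn (hU.mem_nhds hz) hi)

theorem isOpen_image_of_injOn (hU : IsOpen U) (hf : DifferentiableOn ℂ f U) (hi : InjOn f U) :
    IsOpen (f '' U) := by
  rw [isOpen_iff_mem_nhds]
  rintro _ ⟨z, hz, rfl⟩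
  exact nhds_le_map_nhds_of_injOn hU hf hi hz (image_mem_map (hU.mem_nhds hz))

theorem continuousAt_invFunOn_image (hU : IsOpen U) (hf : DifferentiableOn ℂ f U)
    (hi : InjOn f U) (hz : z ∈ U) : ContinuousAt (Function.invFunOn f U) (f z) := by
  have hleft : LeftInvOn (Function.invFunOn f U) f U := hi.leftInvOn_invFunOn
  rw [ContinuousAt, hleft hz]
  refine Tendsto.mono_left ?_ (nhds_le_map_nhds_of_injOn hU hf hi hz)
  rw [tendsto_map'_iff]
  refine tendsto_id.congr' ?_
  filter_upwards [hU.mem_nhds hz] with w hw using (hleft hw).symm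

theorem eventually_deriv_ne_zero_of_injOn (hU : U ∈ 𝓝 z) (hf : DifferentiableOn ℂ f U)
    (hi : InjOn f U) : ∀ᶠ w in 𝓝[≠] z, deriv f w ≠ 0 := by
  refine (hf.analyticAt hU).deriv.eventually_eq_zero_or_eventually_ne_zero.resolve_left
    fun hzero => not_eventually_eq_of_injOn hU hi ?_
  obtain ⟨ε, hε, hball⟩ := Metric.eventually_nhds_iff_ball.1
    (hzero.and (eventually_mem_nhds_iff.2 hU))
  filter_upwards [ball_mem_nhds z hε] with w hw
  exact isOpen_ball.is_const_of_deriv_eq_zero (convex_ball z ε).isPreconnected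
    (fun x hx => (hf.differentiableAt (hball x hx).2).differentiableWithinAt)
    (fun x hx => (hball x hx).1) hw (mem_ball_self hε)

theorem differentiableAt_invFunOn_of_deriv_ne_zero (hU : IsOpen U) (hf : DifferentiableOn ℂ f U)
    (hi : InjOn f U) (hz : z ∈ U) (hd : deriv f z ≠ 0) :
    DifferentiableAt ℂ (Function.invFunOn f U) (f z) := by
  have hderiv : HasDerivAt f (deriv f z) (Function.invFunOn f U (f z)) := by
    rw [hi.leftInvOn_invFunOn hz]
    exact (hf.differentiableAt (hU.mem_nhds hz)).hasDerivAt
  refine (hderiv.of_local_left_inverse (continuousAt_invFunOn_image hU hf hi hz) hd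
    ?_).differentiableAt
  filter_upwards [(isOpen_image_of_injOn hU hf hi).mem_nhds (mem_image_of_mem f hz)] with w hw
  exact Function.invFunOn_eq hw

theorem differentiableOn_invFunOn (hU : IsOpen U) (hf : DifferentiableOn ℂ f U)
    (hi : InjOn f U) : DifferentiableOn ℂ (Function.invFunOn f U) (f '' U) := by
  rintro _ ⟨z, hz, rfl⟩
  -- The critical points of `f` are isolated, so the inverse has removable singularities only.
  refine (Complex.analyticAt_of_differentiable_on_punctured_nhds_of_continuousAt ?_
    (continuousAt_invFunOn_image hU hf hi hz)).differentiableAt.differentiableWithinAt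
  have hcrit := eventually_nhdsWithin_iff.1
    (eventually_deriv_ne_zero_of_injOn (hU.mem_nhds hz) hf hi)
  rw [eventually_nhdsWithin_iff]
  filter_upwards [nhds_le_map_nhds_of_injOn hU hf hi hz
    (image_mem_map (inter_mem hcrit (hU.mem_nhds hz)))]
  rintro _ ⟨w, ⟨hw, hwU⟩, rfl⟩ hne
  exact differentiableAt_invFunOn_of_deriv_ne_zero hU hf hi hwU
    (hw fun h => hne (congrArg f h))

end InjectiveHolomorphic

/-- The intersection of the open disc of centre `t` and radius `a` with the closed upper half
plane. -/
def closedHalfDisc (t a : ℝ) : Set ℂ := ball (t : ℂ) a ∩ {w | 0 ≤ w.im}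

/-- The intersection of the open disc of centre `t` and radius `a` with the open upper half
plane. -/
def openHalfDisc (t a : ℝ) : Set ℂ := ball (t : ℂ) a ∩ {w | 0 < w.im}

/-- `G` is continuous on the half disc up to its diameter, holomorphic inside, and its values on
the diameter are those of `v`. -/
structure IsHalfDiscExtension (v : ℝ → ℂ) (t a : ℝ) (G : ℂ → ℂ) : Prop where
  continuousOn : ContinuousOn G (closedHalfDisc t a)
  differentiableOn : DifferentiableOn ℂ G (openHalfDisc t a)
  eqOn : ∀ x ∈ ball t a, G (x : ℂ) = v x

/-- `v` has an extension to the half disc of centre `t` and radius `a` which is bounded by `M`. -/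
def ExtendsBoundedly (v : ℝ → ℂ) (t a M : ℝ) : Prop :=
  ∃ G, IsHalfDiscExtension v t a G ∧ ∀ w ∈ closedHalfDisc t a, ‖G w‖ ≤ M

section HalfDiscs

variable {t s a b : ℝ}

theorem isOpen_openHalfDisc (t a : ℝ) : IsOpen (openHalfDisc t a) :=
  isOpen_ball.inter (isOpen_lt continuous_const Complex.continuous_im)

theorem convex_openHalfDisc (t a : ℝ) : Convex ℝ (openHalfDisc t a) :=
  (convex_ball _ _).inter (convex_halfSpace_im_gt 0)

theorem openHalfDisc_subset_closedHalfDisc (t a : ℝ) : openHalfDisc t a ⊆ closedHalfDisc t a :=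
  inter_subset_inter_right _ (ofPred_subset_ofPred.2 fun _ => le_of_lt)

theorem ball_ofReal_subset_ball (h : dist s t + b ≤ a) : ball (s : ℂ) b ⊆ ball (t : ℂ) a :=
  ball_subset_ball' (by rw [Complex.isometry_ofReal.dist_eq]; linarith)

theorem closedHalfDisc_mono (h : dist s t + b ≤ a) : closedHalfDisc s b ⊆ closedHalfDisc t a :=
  inter_subset_inter_left _ (ball_ofReal_subset_ball h)

theorem openHalfDisc_mono (h : dist s t + b ≤ a) : openHalfDisc s b ⊆ openHalfDisc t a :=
  inter_subset_inter_left _ (ball_ofReal_subset_ball h)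

theorem ofReal_mem_closedHalfDisc {x : ℝ} (hx : x ∈ ball t a) : (x : ℂ) ∈ closedHalfDisc t a :=
  ⟨by rwa [mem_ball, Complex.isometry_ofReal.dist_eq], by simp⟩

theorem closedHalfDisc_subset_closure (t a : ℝ) :
    closedHalfDisc t a ⊆ closure (openHalfDisc t a) := by
  refine Subset.trans ?_ isOpen_ball.inter_closure
  rw [Complex.closure_setOfPred_lt_im]
  exact Subset.rfl

theorem closure_openHalfDisc_subset (t a : ℝ) :
    closure (openHalfDisc t a) ⊆ closedBall (t : ℂ) a ∩ {w | 0 ≤ w.im} := by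
  refine (closure_inter_subset_inter_closure _ _).trans
    (inter_subset_inter closure_ball_subset_closedBall ?_)
  rw [Complex.closure_setOfPred_lt_im]

theorem closure_openHalfDisc_subset_closedHalfDisc (h : b < a) :
    closure (openHalfDisc t b) ⊆ closedHalfDisc t a :=
  (closure_openHalfDisc_subset t b).trans
    (inter_subset_inter_left _ (closedBall_subset_ball h))

theorem frontier_openHalfDisc_subset (t a : ℝ) :
    frontier (openHalfDisc t a) ⊆
      {w | dist w t ≤ a ∧ w.im = 0} ∪ {w | dist w t = a ∧ 0 ≤ w.im} := by
  intro w hw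
  rw [(isOpen_openHalfDisc t a).frontier_eq] at hw
  obtain ⟨hdist, him⟩ := closure_openHalfDisc_subset t a hw.1
  rcases (mem_closedBall.1 hdist).lt_or_eq with hlt | heq
  · exact Or.inl ⟨hdist, ((him : 0 ≤ w.im).eq_of_not_lt fun h => hw.2 ⟨hlt, h⟩).symm⟩
  · exact Or.inr ⟨heq, him⟩

end HalfDiscs

section TwoConstants

/-- A polynomial whose real part minorizes minus the harmonic measure of the arc in the upper half
of the unit disc: it is `≤ 0` on the diameter and `≤ -1` on the arc. -/
noncomputable def halfDiscWeight (z : ℂ) : ℂ := 2 * Complex.I * z - z ^ 2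

theorem re_halfDiscWeight (z : ℂ) : (halfDiscWeight z).re = z.im ^ 2 - 2 * z.im - z.re ^ 2 := by
  have hsq : (z ^ 2).re = z.re ^ 2 - z.im ^ 2 := by
    rw [pow_two, Complex.mul_re]
    ring
  have hmul : (2 * Complex.I * z).re = -(2 * z.im) := by
    simp [mul_assoc]
  rw [halfDiscWeight, Complex.sub_re, hsq, hmul]
  ring

theorem re_halfDiscWeight_nonpos {z : ℂ} (hz : z.im = 0) : (halfDiscWeight z).re ≤ 0 := by
  rw [re_halfDiscWeight, hz]
  nlinarith [sq_nonneg z.re]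

theorem re_halfDiscWeight_le_neg_one {z : ℂ} (hz : ‖z‖ = 1) (him : 0 ≤ z.im) :
    (halfDiscWeight z).re ≤ -1 := by
  have hsq : z.re ^ 2 = 1 - z.im ^ 2 := by
    linarith [Complex.sq_norm_sub_sq_im z, show ‖z‖ ^ 2 = 1 by rw [hz]; norm_num]
  have him1 : z.im ≤ 1 := (le_abs_self _).trans (hz ▸ Complex.abs_im_le_norm z)
  rw [re_halfDiscWeight, hsq]
  nlinarith

theorem neg_half_le_re_halfDiscWeight {z : ℂ} (hz : ‖z‖ ≤ 1 / 5) :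
    -(1 / 2) ≤ (halfDiscWeight z).re := by
  have him : z.im ≤ 1 / 5 := (le_abs_self _).trans ((Complex.abs_im_le_norm z).trans hz)
  have hre : z.re ^ 2 ≤ (1 / 5) ^ 2 :=
    sq_le_sq' (abs_le.1 ((Complex.abs_re_le_norm z).trans hz)).1
      (abs_le.1 ((Complex.abs_re_le_norm z).trans hz)).2
  rw [re_halfDiscWeight]
  nlinarith [sq_nonneg z.im]

variable {v : ℝ → ℂ} {G : ℂ → ℂ} {t a M ε : ℝ}

theorem norm_mul_exp_le_of_mem_frontier {N : ℝ} (ha : 0 < a) (hN : 0 ≤ N)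
    (hε : ∀ x : ℝ, dist x t ≤ a → ‖G x‖ ≤ ε)
    (hM : ∀ w : ℂ, dist w t = a → 0 ≤ w.im → ‖G w‖ ≤ M)
    {w : ℂ} (hw : w ∈ frontier (openHalfDisc t a)) :
    ‖G w * Complex.exp (N * halfDiscWeight ((w - t) / a))‖ ≤ max ε (M * Real.exp (-N)) := by
  rw [norm_mul, Complex.norm_exp, Complex.re_ofReal_mul]
  rcases frontier_openHalfDisc_subset t a hw with ⟨hdist, him⟩ | ⟨hdist, him⟩
  · have hreal : w = (w.re : ℂ) := Complex.ext rfl (by simpa using him)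
    have hGw : ‖G w‖ ≤ ε := by
      rw [hreal] at hdist ⊢
      exact hε _ (by rwa [Complex.isometry_ofReal.dist_eq] at hdist)
    have hexp : Real.exp (N * (halfDiscWeight ((w - t) / a)).re) ≤ 1 :=
      Real.exp_le_one_iff.2 (mul_nonpos_of_nonneg_of_nonpos hN
        (re_halfDiscWeight_nonpos (by simp [Complex.div_ofReal_im, him])))
    exact le_max_of_le_left
      ((mul_le_of_le_one_right (norm_nonneg _) hexp).trans hGw)
  · have hnorm : ‖(w - t) / a‖ = 1 := by
      rw [norm_div, ← dist_eq_norm, hdist, Complex.norm_of_nonneg ha.le, div_self ha.ne']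
    have hexp : Real.exp (N * (halfDiscWeight ((w - t) / a)).re) ≤ Real.exp (-N) := by
      have := re_halfDiscWeight_le_neg_one hnorm
        (by rw [Complex.div_ofReal_im]; exact div_nonneg (by simpa using him) ha.le)
      exact Real.exp_le_exp.2 (by nlinarith)
    have hGw := hM w hdist him
    exact le_max_of_le_right
      (mul_le_mul hGw hexp (Real.exp_pos _).le ((norm_nonneg _).trans hGw))

namespace IsHalfDiscExtension

theorem norm_mul_exp_neg_half_le (hG : IsHalfDiscExtension v t a G)
    (hε : ∀ x ∈ ball t a, ‖v x‖ ≤ ε) (hM : ∀ w ∈ closedHalfDisc t a, ‖G w‖ ≤ M)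
    {N : ℝ} (hN : 0 ≤ N) {w : ℂ} (hw : w ∈ closedHalfDisc t (a / 10)) :
    ‖G w‖ * Real.exp (-(N / 2)) ≤ max ε (M * Real.exp (-N)) := by
  have ha : 0 < a := by linarith [pos_of_mem_ball hw.1]
  have hlt : a / 2 < a := half_lt_self ha
  have hcl : closure (openHalfDisc t (a / 2)) ⊆ closedHalfDisc t a :=
    closure_openHalfDisc_subset_closedHalfDisc hlt
  have hweight : Differentiable ℂ
      fun z => Complex.exp (N * halfDiscWeight ((z - t) / (a / 2 : ℝ))) := by
    unfold halfDiscWeight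
    fun_prop
  have hdiff : DiffContOnCl ℂ
      (fun z => G z * Complex.exp (N * halfDiscWeight ((z - t) / (a / 2 : ℝ))))
      (openHalfDisc t (a / 2)) :=
    ⟨(hG.differentiableOn.mono (openHalfDisc_mono (by simpa using hlt.le))).mul
      hweight.differentiableOn, (hG.continuousOn.mono hcl).mul hweight.continuous.continuousOn⟩
  have hmax := Complex.norm_le_of_forall_mem_frontier_norm_le
    (isBounded_ball.subset inter_subset_left) hdiff
    (fun z hz => norm_mul_exp_le_of_mem_frontier (half_pos ha) hN
      (fun x hx => by
        have hx' : x ∈ ball t a := hx.trans_lt hlt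
        rw [hG.eqOn x hx']; exact hε x hx')
      (fun z hz him => hM z ⟨hz.trans_lt hlt, him⟩) hz)
    (closedHalfDisc_subset_closure t (a / 2) (closedHalfDisc_mono (by rw [dist_self]; linarith) hw))
  rw [norm_mul, Complex.norm_exp, Complex.re_ofReal_mul] at hmax
  refine le_trans (mul_le_mul_of_nonneg_left (Real.exp_le_exp.2 ?_) (norm_nonneg _)) hmax
  have hsmall : ‖(w - t) / (a / 2 : ℝ)‖ ≤ 1 / 5 := by
    rw [norm_div, ← dist_eq_norm, Complex.norm_of_nonneg (half_pos ha).le,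
      div_le_iff₀ (half_pos ha)]
    linarith [mem_ball.1 hw.1]
  nlinarith [neg_half_le_re_halfDiscWeight hsmall]

theorem sq_norm_le_mul (hG : IsHalfDiscExtension v t a G)
    (hε : ∀ x ∈ ball t a, ‖v x‖ ≤ ε) (hM : ∀ w ∈ closedHalfDisc t a, ‖G w‖ ≤ M)
    {w : ℂ} (hw : w ∈ closedHalfDisc t (a / 10)) : ‖G w‖ ^ 2 ≤ M * ε := by
  have ha : 0 < a := by linarith [pos_of_mem_ball hw.1]
  have hGw : ‖G w‖ ≤ M := hM w (closedHalfDisc_mono (by rw [dist_self]; linarith) hw)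
  have hε0 : 0 ≤ ε := (norm_nonneg _).trans (hε t (mem_ball_self ha))
  have hpos : ∀ η > ε, ‖G w‖ ^ 2 ≤ M * η := by
    intro η hη
    have hη0 : 0 < η := hε0.trans_lt hη
    rcases le_total M η with hMη | hηM
    · calc ‖G w‖ ^ 2 ≤ M ^ 2 := by gcongr
        _ ≤ M * η := by nlinarith [(norm_nonneg _).trans hGw]
    · have hM0 : 0 < M := hη0.trans_le hηM
      -- This `N` balances the two bounds: `M * exp (-N) = η`.
      have hexp : Real.exp (-Real.log (M / η)) = η / M := by
        rw [Real.exp_neg, Real.exp_log (by positivity), inv_div]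
      have hbound := hG.norm_mul_exp_neg_half_le (fun x hx => (hε x hx).trans hη.le) hM
        (Real.log_nonneg ((one_le_div hη0).2 hηM)) hw
      rw [hexp, mul_div_cancel₀ _ hM0.ne', max_self] at hbound
      have hsq := pow_le_pow_left₀ (by positivity) hbound 2
      rw [mul_pow, ← Real.exp_nat_mul, show ((2 : ℕ) : ℝ) * -(Real.log (M / η) / 2) =
        -Real.log (M / η) by push_cast; ring, hexp, ← mul_div_assoc, div_le_iff₀ hM0] at hsq
      nlinarith
  exact ge_of_tendsto (((continuous_const_mul M).tendsto ε).mono_left nhdsWithin_le_nhds)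
    (eventually_nhdsWithin_of_forall (s := Ioi ε) hpos)

end IsHalfDiscExtension

end TwoConstants

namespace IsHalfDiscExtension

variable {v v' : ℝ → ℂ} {G G' : ℂ → ℂ} {t s a b : ℝ}

theorem add (hG : IsHalfDiscExtension v t a G) (hG' : IsHalfDiscExtension v' t a G') :
    IsHalfDiscExtension (v + v') t a (G + G') where
  continuousOn := hG.continuousOn.add hG'.continuousOn
  differentiableOn := hG.differentiableOn.add hG'.differentiableOn
  eqOn x hx := congrArg₂ (· + ·) (hG.eqOn x hx) (hG'.eqOn x hx)

theorem const_smul (c : ℂ) (hG : IsHalfDiscExtension v t a G) :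
    IsHalfDiscExtension (c • v) t a (c • G) where
  continuousOn := hG.continuousOn.const_smul c
  differentiableOn := hG.differentiableOn.const_smul c
  eqOn x hx := congrArg (c • ·) (hG.eqOn x hx)

theorem sub (hG : IsHalfDiscExtension v t a G) (hG' : IsHalfDiscExtension v' t a G') :
    IsHalfDiscExtension (v - v') t a (G - G') := by
  simpa only [neg_one_smul, ← sub_eq_add_neg] using hG.add (hG'.const_smul (-1))

theorem mono (hG : IsHalfDiscExtension v t a G) (h : dist s t + b ≤ a) :
    IsHalfDiscExtension v s b G where
  continuousOn := hG.continuousOn.mono (closedHalfDisc_mono h)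
  differentiableOn := hG.differentiableOn.mono (openHalfDisc_mono h)
  eqOn x hx := hG.eqOn x (ball_subset_ball' (by linarith) hx)

theorem exists_norm_le (hG : IsHalfDiscExtension v t a G) (hb : b < a) :
    ∃ M, ∀ w ∈ closedHalfDisc t b, ‖G w‖ ≤ M := by
  have hcompact : IsCompact (closedBall (t : ℂ) b ∩ {w : ℂ | 0 ≤ w.im}) :=
    (isCompact_closedBall _ _).inter_right (isClosed_le continuous_const Complex.continuous_im)
  obtain ⟨M, hM⟩ := hcompact.exists_bound_of_continuousOn
    (hG.continuousOn.mono (inter_subset_inter_left _ (closedBall_subset_ball hb)))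
  exact ⟨M, fun w hw => hM w ⟨ball_subset_closedBall hw.1, hw.2⟩⟩

theorem eqOn_zero (hG : IsHalfDiscExtension v t a G) (hs : s ∈ ball t a)
    (hv : v =ᶠ[𝓝 s] 0) : EqOn v 0 (ball t a) := by
  obtain ⟨b, hb, hvb⟩ := Metric.eventually_nhds_iff_ball.1
    (hv.and (isOpen_ball.mem_nhds hs))
  obtain ⟨c, hc, hca⟩ := exists_between (lt_min hb (sub_pos.2 (mem_ball.1 hs)))
  obtain ⟨hcb, hcs⟩ := lt_min_iff.1 hca
  obtain ⟨M, hM⟩ := (hG.mono (by linarith : dist s t + (a - dist s t) ≤ a)).exists_norm_le hcs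
  have hGs : ∀ w ∈ closedHalfDisc s (c / 10), G w = 0 := fun w hw => by
    have hsq := (hG.mono (by linarith : dist s t + c ≤ a)).sq_norm_le_mul (ε := 0)
      (fun x hx => by simp [(hvb x (ball_subset_ball hcb.le hx)).1]) hM hw
    rw [mul_zero] at hsq
    exact norm_eq_zero.1 (pow_eq_zero_iff two_ne_zero |>.1 (le_antisymm hsq (sq_nonneg _)))
  obtain ⟨z, hz⟩ : (openHalfDisc s (c / 10)).Nonempty :=
    closure_nonempty_iff.1 ⟨_, closedHalfDisc_subset_closure s (c / 10)
      (ofReal_mem_closedHalfDisc (mem_ball_self (by positivity)))⟩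
  have hGopen : EqOn G 0 (openHalfDisc t a) :=
    (hG.differentiableOn.analyticOnNhd
      (isOpen_openHalfDisc t a)).eqOn_zero_of_preconnected_of_eventuallyEq_zero
      (convex_openHalfDisc t a).isPreconnected (openHalfDisc_mono (by linarith) hz)
      (by
        filter_upwards [(isOpen_openHalfDisc _ _).mem_nhds hz] with w hw using
          hGs w (openHalfDisc_subset_closedHalfDisc _ _ hw))
  intro x hx
  rw [← hG.eqOn x hx]
  exact hGopen.of_subset_closure hG.continuousOn continuousOn_const
    (openHalfDisc_subset_closedHalfDisc t a) (closedHalfDisc_subset_closure t a)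
    (ofReal_mem_closedHalfDisc hx)

end IsHalfDiscExtension

section HalfDiscLimits

variable {ι : Type*} {l : Filter ι} {V : ι → ℝ → ℂ} {t a M : ℝ}

theorem uniformCauchySeqOn_of_isHalfDiscExtension {G : ι → ℂ → ℂ}
    (hV : UniformCauchySeqOn V l (ball t a)) (hG : ∀ i, IsHalfDiscExtension (V i) t a (G i))
    (hM : ∀ i, ∀ w ∈ closedHalfDisc t a, ‖G i w‖ ≤ M) :
    UniformCauchySeqOn G l (closedHalfDisc t (a / 10)) := by
  intro u hu
  obtain ⟨η, hη, hηu⟩ := Metric.mem_uniformity_dist.1 hu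
  have hδ : 0 < η ^ 2 / (2 * |M| + 1) := by positivity
  filter_upwards [hV _ (Metric.dist_mem_uniformity hδ)] with p hp w hw
  refine hηu ?_
  have hsq : ‖(G p.1 - G p.2) w‖ ^ 2 ≤ (M + M) * (η ^ 2 / (2 * |M| + 1)) :=
    ((hG p.1).sub (hG p.2)).sq_norm_le_mul
      (fun x hx => by
        rw [Pi.sub_apply, ← dist_eq_norm]
        exact (hp x hx : dist _ _ < _).le)
      (fun z hz => (norm_sub_le _ _).trans (add_le_add (hM p.1 z hz) (hM p.2 z hz))) hw
  rw [dist_eq_norm]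
  refine lt_of_pow_lt_pow_left₀ 2 hη.le (hsq.trans_lt ?_)
  rw [← mul_div_assoc, div_lt_iff₀ (by positivity)]
  nlinarith [le_abs_self M, sq_pos_of_pos hη]

theorem ExtendsBoundedly.of_tendstoUniformlyOn [l.NeBot] {v : ℝ → ℂ} (ha : 0 < a)
    (hV : TendstoUniformlyOn V v l (ball t a))
    (hext : ∀ i, ExtendsBoundedly (V i) t a M) : ExtendsBoundedly v t (a / 10) M := by
  choose G hG hGM using hext
  have hsub : dist t t + a / 10 ≤ a := by rw [dist_self]; linarith
  have hcauchy : UniformCauchySeqOn G l (closedHalfDisc t (a / 10)) :=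
    uniformCauchySeqOn_of_isHalfDiscExtension hV.uniformCauchySeqOn hG hGM
  have hlim : ∀ w ∈ closedHalfDisc t (a / 10), ∃ z, Tendsto (fun i => G i w) l (𝓝 z) :=
    fun w hw => CompleteSpace.complete (hcauchy.cauchy_map hw)
  choose! F hF using hlim
  have hunif : TendstoUniformlyOn G F l (closedHalfDisc t (a / 10)) :=
    hcauchy.tendstoUniformlyOn_of_tendsto hF
  refine ⟨F, ⟨hunif.continuousOn (.of_forall fun i => ((hG i).mono hsub).continuousOn), ?_, ?_⟩,
    fun w hw => ?_⟩
  · exact (hunif.mono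
      (openHalfDisc_subset_closedHalfDisc _ _)).tendstoLocallyUniformlyOn.differentiableOn
      (.of_forall fun i => ((hG i).mono hsub).differentiableOn) (isOpen_openHalfDisc _ _)
  · intro x hx
    refine tendsto_nhds_unique (hF x (ofReal_mem_closedHalfDisc hx))
      ((hV.tendsto_at (ball_subset_ball (by linarith) hx)).congr fun i => ?_)
    exact (((hG i).mono hsub).eqOn x hx).symm
  · exact le_of_tendsto (hF w hw).norm
      (.of_forall fun i => hGM i w (closedHalfDisc_mono hsub hw))

end HalfDiscLimits

section SchwarzPick

open ComplexConjugate

theorem one_sub_conj_mul_ne_zero {a w : ℂ} (ha : ‖a‖ < 1) (hw : ‖w‖ < 1) :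
    1 - conj a * w ≠ 0 := by
  intro h
  have hnorm : ‖a‖ * ‖w‖ = 1 := by
    simpa only [norm_mul, RCLike.norm_conj, norm_one] using congrArg norm (sub_eq_zero.1 h).symm
  nlinarith [norm_nonneg a, norm_nonneg w]

theorem norm_sub_div_one_sub_conj_mul_lt_one {a w : ℂ} (ha : ‖a‖ < 1) (hw : ‖w‖ < 1) :
    ‖(w - a) / (1 - conj a * w)‖ < 1 := by
  rw [norm_div, div_lt_one (norm_pos_iff.2 (one_sub_conj_mul_ne_zero ha hw))]
  have hid : ‖1 - conj a * w‖ ^ 2 - ‖w - a‖ ^ 2 = (1 - ‖w‖ ^ 2) * (1 - ‖a‖ ^ 2) := by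
    simp only [Complex.sq_norm, Complex.normSq_apply, Complex.sub_re, Complex.sub_im,
      Complex.mul_re, Complex.mul_im, Complex.conj_re, Complex.conj_im, Complex.one_re,
      Complex.one_im]
    ring
  have hpos : 0 < (1 - ‖w‖ ^ 2) * (1 - ‖a‖ ^ 2) :=
    mul_pos (sub_pos.2 (pow_lt_one₀ (norm_nonneg _) hw two_ne_zero))
      (sub_pos.2 (pow_lt_one₀ (norm_nonneg _) ha two_ne_zero))
  exact lt_of_pow_lt_pow_left₀ 2 (norm_nonneg _) (by linarith)

theorem hasDerivAt_sub_div_one_sub_conj_mul {a : ℂ} (ha : ‖a‖ < 1) :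
    HasDerivAt (fun w => (w - a) / (1 - conj a * w)) (1 / (1 - ‖a‖ ^ 2)) a := by
  have hne := one_sub_conj_mul_ne_zero ha ha
  have hnum : HasDerivAt (fun w : ℂ => w - a) 1 a := (hasDerivAt_id a).sub_const a
  have hden : HasDerivAt (fun w : ℂ => 1 - conj a * w) (-(conj a * 1)) a :=
    ((hasDerivAt_id a).const_mul _).const_sub 1
  refine (hnum.fun_div hden hne).congr_deriv ?_
  rw [← Complex.conj_mul' a]
  field_simp
  ring

theorem norm_deriv_le_one_sub_sq_div_of_mapsTo_ball {f : ℂ → ℂ} {z : ℂ} {d : ℝ} (hd : 0 < d)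
    (hf : DifferentiableOn ℂ f (ball z d)) (hm : MapsTo f (ball z d) (ball 0 1)) :
    ‖deriv f z‖ ≤ (1 - ‖f z‖ ^ 2) / d := by
  have hlt : ∀ w ∈ ball z d, ‖f w‖ < 1 := fun w hw => mem_ball_zero_iff.1 (hm hw)
  have hfz := hlt z (mem_ball_self hd)
  set g : ℂ → ℂ := fun w => (f w - f z) / (1 - conj (f z) * f w)
  have hg : DifferentiableOn ℂ g (ball z d) :=
    (hf.sub_const _).div ((hf.const_mul _).const_sub 1)
      fun w hw => one_sub_conj_mul_ne_zero hfz (hlt w hw)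
  have hgm : MapsTo g (ball z d) (closedBall (g z) 1) := fun w hw => by
    simpa [g] using (norm_sub_div_one_sub_conj_mul_lt_one hfz (hlt w hw)).le
  have hderiv : deriv g z = 1 / (1 - ‖f z‖ ^ 2) * deriv f z :=
    ((hasDerivAt_sub_div_one_sub_conj_mul hfz).comp z
      (hf.differentiableAt (ball_mem_nhds z hd)).hasDerivAt).deriv
  have hpos : 0 < 1 - ‖f z‖ ^ 2 := sub_pos.2 (pow_lt_one₀ (norm_nonneg _) hfz two_ne_zero)
  have hschwarz := Complex.norm_deriv_le_div_of_mapsTo_ball hg hgm hd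
  have hnorm : ‖(1 / (1 - ‖f z‖ ^ 2) : ℂ)‖ = 1 / (1 - ‖f z‖ ^ 2) := by
    rw [show (1 / (1 - ‖f z‖ ^ 2) : ℂ) = ((1 / (1 - ‖f z‖ ^ 2) : ℝ) : ℂ) by push_cast; rfl,
      Complex.norm_of_nonneg (one_div_pos.2 hpos).le]
  rw [hderiv, norm_mul, hnorm, div_mul_eq_mul_div, one_mul, div_le_iff₀ hpos] at hschwarz
  rwa [div_mul_eq_mul_div, one_mul] at hschwarz

end SchwarzPick

section Annulus

/-- The open annulus `r < ‖z‖ < R`. -/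
noncomputable def annulus (r R : ℝ) : Set ℂ := norm ⁻¹' Ioo r R

/-- The filter of neighbourhoods of the unit circle in the open unit disc. -/
noncomputable def innerCircle : Filter ℂ := comap norm (𝓝[<] 1)

theorem hasBasis_innerCircle : innerCircle.HasBasis (· < 1) (annulus · 1) :=
  (nhdsLT_basis 1).comap norm

theorem annulus_mem_innerCircle {r R : ℝ} (hr : r < 1) (hR : 1 < R) :
    annulus r R ∈ innerCircle :=
  mem_of_superset (hasBasis_innerCircle.mem_of_mem hr)
    (preimage_mono (Ioo_subset_Ioo_right hR.le))

theorem ball_zero_mem_innerCircle : ball (0 : ℂ) 1 ∈ innerCircle :=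
  mem_of_superset (hasBasis_innerCircle.mem_of_mem zero_lt_one)
    fun _ hz => mem_ball_zero_iff.2 hz.2

theorem isOpen_annulus (r R : ℝ) : IsOpen (annulus r R) :=
  isOpen_Ioo.preimage continuous_norm

theorem closure_annulus_subset (r R : ℝ) : closure (annulus r R) ⊆ norm ⁻¹' Icc r R :=
  closure_minimal (preimage_mono Ioo_subset_Icc_self) (isClosed_Icc.preimage continuous_norm)

theorem norm_eq_of_mem_frontier_annulus {r R : ℝ} (h : r < R) {z : ℂ}
    (hz : z ∈ frontier (annulus r R)) : ‖z‖ = r ∨ ‖z‖ = R := by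
  simpa [frontier_Ioo h] using continuous_norm.frontier_preimage_subset _ hz

theorem nhdsWithin_ball_le_innerCircle {ζ : ℂ} (hζ : ζ ∈ sphere (0 : ℂ) 1) :
    𝓝[ball 0 1] ζ ≤ innerCircle := by
  rw [innerCircle, ← tendsto_iff_comap]
  refine tendsto_nhdsWithin_iff.2 ⟨?_, ?_⟩
  · rw [← mem_sphere_zero_iff_norm.1 hζ]
    exact continuous_norm.continuousAt.mono_left nhdsWithin_le_nhds
  · filter_upwards [self_mem_nhdsWithin] with z hz using mem_ball_zero_iff.1 hz

theorem nhdsWithin_ball_neBot {ζ : ℂ} (hζ : ζ ∈ sphere (0 : ℂ) 1) : (𝓝[ball 0 1] ζ).NeBot := by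
  rw [← mem_closure_iff_nhdsWithin_neBot, closure_ball _ one_ne_zero]
  exact sphere_subset_closedBall hζ

theorem norm_le_one_of_eventually_innerCircle {g : ℂ → ℂ} {ρ σ : ℝ} (hρσ : ρ < σ)
    (hg : DifferentiableOn ℂ g (annulus ρ 1)) (hσ : ∀ z, ‖z‖ = σ → ‖g z‖ ≤ 1)
    (hlim : ∀ C > 1, ∀ᶠ z in innerCircle, ‖g z‖ ≤ C) {z : ℂ} (hz : z ∈ annulus σ 1) :
    ‖g z‖ ≤ 1 := by
  refine le_of_forall_gt_imp_ge_of_dense fun C hC => ?_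
  obtain ⟨s, hs, hsC⟩ := hasBasis_innerCircle.eventually_iff.1 (hlim C hC)
  obtain ⟨τ, hτ, hτ1⟩ := exists_between (max_lt hs hz.2)
  obtain ⟨hsτ, hzτ⟩ := max_lt_iff.1 hτ
  have hsub : closure (annulus σ τ) ⊆ annulus ρ 1 :=
    (closure_annulus_subset σ τ).trans
      (preimage_mono fun x hx => ⟨hρσ.trans_le hx.1, hx.2.trans_lt hτ1⟩)
  have hbdd : Bornology.IsBounded (annulus σ τ) :=
    isBounded_ball.subset fun w hw => mem_ball_zero_iff.2 hw.2
  refine Complex.norm_le_of_forall_mem_frontier_norm_le hbdd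
    ⟨hg.mono (subset_closure.trans hsub), hg.continuousOn.mono hsub⟩ (fun w hw => ?_)
    (subset_closure ⟨hz.1, hzτ⟩)
  rcases norm_eq_of_mem_frontier_annulus (hz.1.trans hzτ) hw with h | h
  · exact (hσ w h).trans hC.le
  · exact hsC ⟨h ▸ hsτ, h ▸ hτ1⟩

end Annulus

section BoundaryLimits

variable {f g : ℂ → ℂ}

theorem exists_pow_le_norm (hd : ∀ᶠ z in innerCircle, DifferentiableAt ℂ f z)
    (hf : Tendsto f innerCircle innerCircle) :
    ∃ m : ℕ, ∀ᶠ z in innerCircle, ‖z‖ ^ m ≤ ‖f z‖ := by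
  have hlow : ∀ c < 1, ∀ᶠ z in innerCircle, c < ‖f z‖ := fun c hc =>
    (hf.eventually (hasBasis_innerCircle.mem_of_mem hc)).mono fun _ hz => hz.1
  obtain ⟨ρ, hρ, hρf⟩ := hasBasis_innerCircle.eventually_iff.1 (hd.and (hlow (1 / 2) (by norm_num)))
  obtain ⟨σ, hσ, hσ1⟩ := exists_between (max_lt hρ zero_lt_one)
  obtain ⟨hρσ, hσ0⟩ := max_lt_iff.1 hσ
  obtain ⟨m, hm⟩ := exists_pow_lt_of_lt_one (show (0 : ℝ) < 1 / 2 by norm_num) hσ1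
  have hpos : ∀ z ∈ annulus ρ 1, 0 < ‖f z‖ := fun z hz => by linarith [(hρf hz).2]
  -- The maximum principle is applied to `z ^ m / f z`.
  have hg : DifferentiableOn ℂ (fun z => z ^ m / f z) (annulus ρ 1) := fun z hz =>
    ((differentiableAt_id.pow m).div (hρf hz).1
      (norm_pos_iff.1 (hpos z hz))).differentiableWithinAt
  have hle : ∀ z ∈ annulus σ 1, ‖z ^ m / f z‖ ≤ 1 := by
    refine fun z hz => norm_le_one_of_eventually_innerCircle hρσ hg (fun w hw => ?_)
      (fun C hC => ?_) hz
    · have hwρ : w ∈ annulus ρ 1 := ⟨hw ▸ hρσ, hw ▸ hσ1⟩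
      rw [norm_div, norm_pow, div_le_one (hpos w hwρ), hw]
      linarith [(hρf hwρ).2]
    · filter_upwards [hlow C⁻¹ (inv_lt_one_of_one_lt₀ hC), ball_zero_mem_innerCircle] with w hw hw1
      have hfw : 0 < ‖f w‖ := (inv_pos.2 (zero_lt_one.trans hC)).trans hw
      rw [norm_div, norm_pow, div_le_iff₀ hfw]
      calc ‖w‖ ^ m ≤ 1 := pow_le_one₀ (norm_nonneg w) (mem_ball_zero_iff.1 hw1).le
        _ ≤ C * ‖f w‖ := ((inv_lt_iff_one_lt_mul₀' (zero_lt_one.trans hC)).1 hw).le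
  refine ⟨m, hasBasis_innerCircle.eventually_iff.2 ⟨σ, hσ1, fun z hz => ?_⟩⟩
  have hzρ : z ∈ annulus ρ 1 := ⟨hρσ.trans hz.1, hz.2⟩
  have := hle z hz
  rwa [norm_div, norm_pow, div_le_one (hpos z hzρ)] at this

theorem exists_norm_deriv_le (hd : ∀ᶠ z in innerCircle, DifferentiableAt ℂ f z)
    (hf : Tendsto f innerCircle innerCircle) :
    ∃ C : ℝ, ∀ᶠ z in innerCircle, ‖deriv f z‖ ≤ C := by
  obtain ⟨m, hm⟩ := exists_pow_le_norm hd hf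
  obtain ⟨ρ, hρ, hρf⟩ := hasBasis_innerCircle.eventually_iff.1
    ((hd.and (hf ball_zero_mem_innerCircle)).and hm)
  refine ⟨2 * m, hasBasis_innerCircle.eventually_iff.2
    ⟨(1 + ρ) / 2, by linarith, fun z ⟨hzρ, hz1⟩ => ?_⟩⟩
  have hsub : ball z (1 - ‖z‖) ⊆ annulus ρ 1 := by
    intro w hw
    rw [mem_ball, dist_eq_norm] at hw
    have := abs_lt.1 ((abs_norm_sub_norm_le w z).trans_lt hw)
    constructor <;> linarith
  have hfz1 : ‖f z‖ < 1 := mem_ball_zero_iff.1 (hρf (hsub (mem_ball_self (sub_pos.2 hz1)))).1.2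
  have hpow : ‖z‖ ^ m ≤ ‖f z‖ := (hρf (hsub (mem_ball_self (sub_pos.2 hz1)))).2
  have hbernoulli : 1 - m * (1 - ‖z‖) ≤ ‖z‖ ^ m := by
    have := one_add_mul_le_pow (show -2 ≤ ‖z‖ - 1 by linarith [norm_nonneg z]) m
    rw [add_sub_cancel] at this
    linarith
  calc ‖deriv f z‖ ≤ (1 - ‖f z‖ ^ 2) / (1 - ‖z‖) :=
        norm_deriv_le_one_sub_sq_div_of_mapsTo_ball (sub_pos.2 hz1)
          (fun w hw => (hρf (hsub hw)).1.1.differentiableWithinAt) fun w hw => (hρf (hsub hw)).1.2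
    _ ≤ 2 * m := by
      rw [div_le_iff₀ (sub_pos.2 hz1)]
      nlinarith [norm_nonneg (f z)]

theorem exists_tendsto_of_tendsto_innerCircle
    (hd : ∀ᶠ z in innerCircle, DifferentiableAt ℂ f z) (hf : Tendsto f innerCircle innerCircle)
    {ζ : ℂ} (hζ : ζ ∈ sphere (0 : ℂ) 1) :
    ∃ l ∈ sphere (0 : ℂ) 1, Tendsto f (𝓝[ball 0 1] ζ) (𝓝 l) := by
  obtain ⟨C, hC⟩ := exists_norm_deriv_le hd hf
  obtain ⟨ρ, hρ, hρf⟩ := hasBasis_innerCircle.eventually_iff.1 (hd.and hC)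
  have hsub : ball ζ (1 - ρ) ∩ ball 0 1 ⊆ annulus ρ 1 := by
    rintro w ⟨hwζ, hw⟩
    rw [mem_ball', dist_eq_norm] at hwζ
    refine ⟨?_, mem_ball_zero_iff.1 hw⟩
    linarith [norm_sub_norm_le ζ w, mem_sphere_zero_iff_norm.1 hζ]
  have hlip : LipschitzOnWith C.toNNReal f (ball ζ (1 - ρ) ∩ ball 0 1) :=
    ((convex_ball _ _).inter (convex_ball _ _)).lipschitzOnWith_of_nnnorm_deriv_le
      (fun w hw => (hρf (hsub hw)).1)
      fun w hw => NNReal.le_toNNReal_of_coe_le (hρf (hsub hw)).2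
  have := nhdsWithin_ball_neBot hζ
  obtain ⟨l, hl⟩ := CompleteSpace.complete <|
    (cauchy_nhds.mono nhdsWithin_le_nhds).map_of_le hlip.uniformContinuousOn <|
      le_principal_iff.2 (inter_mem (mem_nhdsWithin_of_mem_nhds (ball_mem_nhds ζ (sub_pos.2 hρ)))
        (self_mem_nhdsWithin (a := ζ)))
  have hnorm : Tendsto norm innerCircle (𝓝 1) := tendsto_comap.mono_right nhdsWithin_le_nhds
  refine ⟨l, mem_sphere_zero_iff_norm.2 (tendsto_nhds_unique (Tendsto.norm hl) ?_), hl⟩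
  exact hnorm.comp (hf.mono_left (nhdsWithin_ball_le_innerCircle hζ))

theorem tendsto_nhdsWithin_ball_of_tendsto_innerCircle (hf : Tendsto f innerCircle innerCircle)
    {ζ l : ℂ} (hζ : ζ ∈ sphere (0 : ℂ) 1) (hl : Tendsto f (𝓝[ball 0 1] ζ) (𝓝 l)) :
    Tendsto f (𝓝[ball 0 1] ζ) (𝓝[ball 0 1] l) :=
  tendsto_nhdsWithin_iff.2
    ⟨hl, nhdsWithin_ball_le_innerCircle hζ (hf ball_zero_mem_innerCircle)⟩

theorem exists_bijOn_sphere_tendsto (hfd : ∀ᶠ z in innerCircle, DifferentiableAt ℂ f z)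
    (hgd : ∀ᶠ z in innerCircle, DifferentiableAt ℂ g z) (hf : Tendsto f innerCircle innerCircle)
    (hg : Tendsto g innerCircle innerCircle) (hgf : ∀ᶠ z in innerCircle, g (f z) = z)
    (hfg : ∀ᶠ z in innerCircle, f (g z) = z) :
    ∃ τ : ℂ → ℂ, BijOn τ (sphere 0 1) (sphere 0 1) ∧
      ∀ ζ ∈ sphere (0 : ℂ) 1, Tendsto f (𝓝[ball 0 1] ζ) (𝓝 (τ ζ)) := by
  have inverse_of_limits : ∀ {f g τ κ : ℂ → ℂ}, Tendsto f innerCircle innerCircle →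
      (∀ᶠ z in innerCircle, g (f z) = z) → MapsTo τ (sphere 0 1) (sphere 0 1) →
      (∀ ζ ∈ sphere (0 : ℂ) 1, Tendsto f (𝓝[ball 0 1] ζ) (𝓝 (τ ζ))) →
      (∀ ζ ∈ sphere (0 : ℂ) 1, Tendsto g (𝓝[ball 0 1] ζ) (𝓝 (κ ζ))) →
      LeftInvOn κ τ (sphere 0 1) := by
    intro f g τ κ hf hgf hτm hτ hκ ζ hζ
    have := nhdsWithin_ball_neBot hζ
    have hcomp : Tendsto (fun z => g (f z)) (𝓝[ball 0 1] ζ) (𝓝 (κ (τ ζ))) :=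
      (hκ _ (hτm hζ)).comp (tendsto_nhdsWithin_ball_of_tendsto_innerCircle hf hζ (hτ ζ hζ))
    exact tendsto_nhds_unique_of_eventuallyEq hcomp (tendsto_id.mono_left nhdsWithin_le_nhds)
      (nhdsWithin_ball_le_innerCircle hζ hgf)
  choose! τ hτm hτ using fun ζ => exists_tendsto_of_tendsto_innerCircle hfd hf (ζ := ζ)
  choose! κ hκm hκ using fun ζ => exists_tendsto_of_tendsto_innerCircle hgd hg (ζ := ζ)
  exact ⟨τ, InvOn.bijOn ⟨inverse_of_limits hf hgf hτm hτ hκ, inverse_of_limits hg hfg hκm hκ hτ⟩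
    hτm hκm, hτ⟩

end BoundaryLimits

section Frontier

variable {X Y : Type*} [TopologicalSpace X] [TopologicalSpace Y] [T2Space X] [T2Space Y]

theorem mem_nhdsSetWithin_frontier_iff {S V : Set X} (hS : IsOpen S)
    (hc : IsCompact (closure S)) :
    V ∈ 𝓝ˢ[S] (frontier S) ↔ ∃ C ⊆ S, IsCompact C ∧ S \ C ⊆ V := by
  rw [mem_nhdsSetWithin]
  constructor
  · rintro ⟨W, hW, hSW, hWV⟩
    refine ⟨closure S \ W, fun x hx => by_contra fun hxS => hx.2 (hSW ?_), hc.diff hW,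
      fun x hx => hWV ⟨by_contra fun h => hx.2 ⟨subset_closure hx.1, h⟩, hx.1⟩⟩
    exact ⟨hx.1, by rwa [hS.interior_eq]⟩
  · rintro ⟨C, hCS, hC, hCV⟩
    refine ⟨Cᶜ, hC.isClosed.isOpen_compl, fun x hx hxC => ?_, fun x hx => hCV ⟨hx.2, hx.1⟩⟩
    exact hx.2 (by rw [hS.interior_eq]; exact hCS hxC)

theorem tendsto_nhdsSetWithin_frontier {f : X → Y} {g : Y → X} {S : Set X} {T : Set Y}
    (hS : IsOpen S) (hSc : IsCompact (closure S)) (hT : IsOpen T) (hTc : IsCompact (closure T))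
    (hf : MapsTo f S T) (hg : MapsTo g T S) (hgc : ContinuousOn g T) (hgf : LeftInvOn g f S) :
    Tendsto f (𝓝ˢ[S] (frontier S)) (𝓝ˢ[T] (frontier T)) := by
  intro V hV
  obtain ⟨C, hCT, hC, hCV⟩ := (mem_nhdsSetWithin_frontier_iff hT hTc).1 hV
  refine (mem_nhdsSetWithin_frontier_iff hS hSc).2
    ⟨g '' C, (image_mono hCT).trans hg.image_subset, hC.image_of_continuousOn (hgc.mono hCT), ?_⟩
  exact fun x hx => hCV ⟨hf hx.1, fun hfx => hx.2 ⟨f x, hfx, hgf hx.1⟩⟩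

end Frontier

theorem innerCircle_eq : innerCircle = 𝓝ˢ[ball 0 1] (sphere (0 : ℂ) 1) := by
  have hdist : dist (0 : ℂ) = norm := funext dist_zero_left
  have hsphere : sphere (0 : ℂ) 1 = norm ⁻¹' {1} := by ext; simp
  have hball : ball (0 : ℂ) 1 = norm ⁻¹' Iio 1 := by ext; simp
  rw [innerCircle, nhdsWithin, comap_inf, comap_principal, nhdsSetWithin, hsphere, hball,
    (hdist ▸ isClosedMap_dist (0 : ℂ) : IsClosedMap (norm : ℂ → ℝ)).comap_nhds_eq continuous_norm]

section Components

/-- `S` is a union of connected components of `A`. -/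
def IsUnionOfComponents (S A : Set ℂ) : Prop :=
  S ⊆ A ∧ ∀ z ∈ S, connectedComponentIn A z ⊆ S

namespace IsUnionOfComponents

variable {K S V A : Set ℂ}

theorem subset_of_isPreconnected (h : IsUnionOfComponents S A) (hV : IsPreconnected V)
    (hVA : V ⊆ A) (hne : (V ∩ S).Nonempty) : V ⊆ S := by
  obtain ⟨z, hzV, hzS⟩ := hne
  exact (hV.subset_connectedComponentIn hzV hVA).trans (h.2 z hzS)

theorem isOpen (h : IsUnionOfComponents S A) (hA : IsOpen A) : IsOpen S :=
  isOpen_iff_mem_nhds.2 fun z hz => mem_of_superset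
    (hA.connectedComponentIn.mem_nhds (mem_connectedComponentIn (h.1 hz))) (h.2 z hz)

theorem frontier_subset (h : IsUnionOfComponents S Kᶜ) (hK : IsClosed K) : frontier S ⊆ K := by
  refine fun z hz => by_contra fun hzK => ?_
  have hzC : z ∈ connectedComponentIn Kᶜ z := mem_connectedComponentIn hzK
  obtain ⟨w, hw⟩ := mem_closure_iff.1 hz.1 _ hK.isOpen_compl.connectedComponentIn hzC
  have hsub := h.subset_of_isPreconnected isPreconnected_connectedComponentIn
    (connectedComponentIn_subset _ _) ⟨w, hw⟩
  exact hz.2 (by rw [(h.isOpen hK.isOpen_compl).interior_eq]; exact hsub hzC)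

theorem inter_nonempty_of_subset_isOpen (h : IsUnionOfComponents S Kᶜ) (hK : IsClosed K)
    (hKne : K.Nonempty) (hSne : S.Nonempty) (hV : IsOpen V) (hKV : K ⊆ V) : (V ∩ S).Nonempty := by
  obtain ⟨k, hk⟩ := hKne
  obtain ⟨z, hz⟩ := nonempty_frontier_iff.2 ⟨hSne, fun hS => h.1 (hS ▸ mem_univ k) hk⟩
  exact mem_closure_iff.1 hz.1 V hV (hKV (h.frontier_subset hK hz))

end IsUnionOfComponents

variable {K : Set ℂ}

theorem isUnionOfComponents_boundedSide (K : Set ℂ) : IsUnionOfComponents (boundedSide K) Kᶜ :=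
  ⟨fun _ hz => hz.1, fun _ hz _ hw =>
    ⟨connectedComponentIn_subset _ _ hw, connectedComponentIn_eq hw ▸ hz.2⟩⟩

theorem isUnionOfComponents_unboundedSide (K : Set ℂ) :
    IsUnionOfComponents (unboundedSide K) Kᶜ :=
  ⟨fun _ hz => hz.1, fun _ hz _ hw =>
    ⟨connectedComponentIn_subset _ _ hw, connectedComponentIn_eq hw ▸ hz.2⟩⟩

theorem disjoint_boundedSide_unboundedSide (K : Set ℂ) :
    Disjoint (boundedSide K) (unboundedSide K) :=
  disjoint_left.2 fun _ hb hu => hu.2 hb.2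

theorem isPreconnected_norm_preimage {I : Set ℝ} (hI : IsPreconnected I) (h : I ⊆ Ici 0) :
    IsPreconnected (norm ⁻¹' I : Set ℂ) := by
  have himage : norm ⁻¹' I =
      (fun p : ℝ × ℝ => (p.1 : ℂ) * Complex.exp (p.2 * Complex.I)) '' (I ×ˢ univ) := by
    ext z
    constructor
    · exact fun hz => ⟨(‖z‖, z.arg), ⟨hz, mem_univ _⟩, Complex.norm_mul_exp_arg_mul_I z⟩
    · rintro ⟨⟨s, t⟩, ⟨hs, -⟩, rfl⟩
      have hs0 : 0 ≤ s := h hs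
      simpa [abs_of_nonneg hs0] using hs
  rw [himage]
  exact (hI.prod isPreconnected_univ).image _ (by fun_prop)

theorem exists_compl_closedBall_subset_unboundedSide (hK : Bornology.IsBounded K) :
    ∃ ρ : ℝ, (closedBall (0 : ℂ) ρ)ᶜ ⊆ unboundedSide K := by
  obtain ⟨ρ, hρ, hKρ⟩ := hK.subset_closedBall_lt 0 0
  have hconn : IsPreconnected (closedBall (0 : ℂ) ρ)ᶜ := by
    convert isPreconnected_norm_preimage (isPreconnected_Ioi (a := ρ)) (Ioi_subset_Ici hρ.le)
    ext z
    simp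
  refine ⟨ρ, fun z hz => ⟨fun hzK => hz (hKρ hzK), fun hb => ?_⟩⟩
  have hcompl := hb.subset (hconn.subset_connectedComponentIn hz (compl_subset_compl.2 hKρ))
  exact NormedSpace.unbounded_univ ℂ ℂ
    (union_compl_self (closedBall (0 : ℂ) ρ) ▸ isBounded_closedBall.union hcompl)

theorem isBounded_boundedSide (hK : Bornology.IsBounded K) :
    Bornology.IsBounded (boundedSide K) := by
  obtain ⟨ρ, hρ⟩ := exists_compl_closedBall_subset_unboundedSide hK
  exact isBounded_closedBall.subset fun z hz => by_contra fun h =>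
    disjoint_left.1 (disjoint_boundedSide_unboundedSide K) hz (hρ h)

theorem unboundedSide_nonempty (hK : Bornology.IsBounded K) : (unboundedSide K).Nonempty := by
  obtain ⟨ρ, hρ⟩ := exists_compl_closedBall_subset_unboundedSide hK
  have hne : ((closedBall (0 : ℂ) ρ)ᶜ).Nonempty := nonempty_compl.2 fun h =>
    NormedSpace.unbounded_univ ℂ ℂ (h ▸ isBounded_closedBall)
  exact hne.mono hρ

end Components

section Charts

/-- `Ψ` is a conformal chart around `K`, given by an annulus containing the unit circle: `Ψ` is
holomorphic and injective on the annulus and maps the unit circle onto `K`. -/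
structure IsAnnularChart (K : Set ℂ) (Ψ : ℂ → ℂ) (r R : ℝ) : Prop where
  r_pos : 0 < r
  r_lt_one : r < 1
  one_lt_R : 1 < R
  differentiableOn : DifferentiableOn ℂ Ψ (annulus r R)
  injOn : InjOn Ψ (annulus r R)
  image_sphere : Ψ '' sphere 0 1 = K

theorem inv_mem_annulus {r R : ℝ} (hr : 0 < r) (hR : 0 < R) {z : ℂ}
    (hz : z ∈ annulus R⁻¹ r⁻¹) : z⁻¹ ∈ annulus r R := by
  have hz0 : 0 < ‖z‖ := (inv_pos.2 hR).trans hz.1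
  rw [annulus, mem_preimage, norm_inv]
  exact ⟨(lt_inv_comm₀ hz0 hr).1 hz.2, (inv_lt_comm₀ hR hz0).1 hz.1⟩

theorem annulus_nonempty {r R : ℝ} (hr : 0 ≤ r) (h : r < R) : (annulus r R).Nonempty := by
  obtain ⟨s, hs⟩ := exists_between h
  exact ⟨s, by simpa [annulus, abs_of_pos (hr.trans_lt hs.1)] using hs⟩

theorem isPreconnected_annulus {r R : ℝ} (hr : 0 ≤ r) : IsPreconnected (annulus r R) :=
  isPreconnected_norm_preimage isPreconnected_Ioo fun _ hx => hr.trans hx.1.le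

namespace IsAnnularChart

variable {K S : Set ℂ} {Ψ : ℂ → ℂ} {r R : ℝ}

theorem sphere_subset (h : IsAnnularChart K Ψ r R) : sphere (0 : ℂ) 1 ⊆ annulus r R :=
  fun z hz => by simp [annulus, mem_sphere_zero_iff_norm.1 hz, h.r_lt_one, h.one_lt_R]

theorem inner_subset (h : IsAnnularChart K Ψ r R) : annulus r 1 ⊆ annulus r R :=
  preimage_mono (Ioo_subset_Ioo_right h.one_lt_R.le)

theorem outer_subset (h : IsAnnularChart K Ψ r R) : annulus 1 R ⊆ annulus r R :=
  preimage_mono (Ioo_subset_Ioo_left h.r_lt_one.le)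

theorem continuousOn_sphere (h : IsAnnularChart K Ψ r R) : ContinuousOn Ψ (sphere 0 1) :=
  h.differentiableOn.continuousOn.mono h.sphere_subset

theorem isCompact (h : IsAnnularChart K Ψ r R) : IsCompact K :=
  h.image_sphere ▸ (isCompact_sphere 0 1).image_of_continuousOn h.continuousOn_sphere

theorem nonempty (h : IsAnnularChart K Ψ r R) : K.Nonempty :=
  h.image_sphere ▸ (NormedSpace.sphere_nonempty.2 zero_le_one).image Ψ

theorem mapsTo_sphere (h : IsAnnularChart K Ψ r R) : MapsTo Ψ (sphere 0 1) K :=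
  h.image_sphere ▸ mapsTo_image Ψ _

theorem mem_curve_iff (h : IsAnnularChart K Ψ r R) {z : ℂ} (hz : z ∈ annulus r R) :
    Ψ z ∈ K ↔ ‖z‖ = 1 := by
  rw [← h.image_sphere, h.injOn.mem_image_iff h.sphere_subset hz, mem_sphere_zero_iff_norm]

theorem isOpen_image (h : IsAnnularChart K Ψ r R) : IsOpen (Ψ '' annulus r R) :=
  isOpen_image_of_injOn (isOpen_annulus r R) h.differentiableOn h.injOn

theorem subset_image (h : IsAnnularChart K Ψ r R) : K ⊆ Ψ '' annulus r R :=
  h.image_sphere ▸ image_mono h.sphere_subset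

theorem inv (h : IsAnnularChart K Ψ r R) : IsAnnularChart K (fun z => Ψ z⁻¹) R⁻¹ r⁻¹ where
  r_pos := inv_pos.2 (zero_lt_one.trans h.one_lt_R)
  r_lt_one := inv_lt_one_of_one_lt₀ h.one_lt_R
  one_lt_R := (one_lt_inv₀ h.r_pos).2 h.r_lt_one
  differentiableOn := h.differentiableOn.comp
    (fun z hz => (differentiableAt_inv (norm_pos_iff.1
      ((inv_pos.2 (zero_lt_one.trans h.one_lt_R)).trans hz.1))).differentiableWithinAt)
    fun _ hz => inv_mem_annulus h.r_pos (zero_lt_one.trans h.one_lt_R) hz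
  injOn := fun _ hz _ hw hzw => inv_injective <|
    h.injOn (inv_mem_annulus h.r_pos (zero_lt_one.trans h.one_lt_R) hz)
      (inv_mem_annulus h.r_pos (zero_lt_one.trans h.one_lt_R) hw) hzw
  image_sphere := by
    have hinv : Inv.inv '' sphere (0 : ℂ) 1 = sphere 0 1 := by
      rw [image_inv_eq_inv]
      ext z
      simp
    rw [← h.image_sphere, ← image_image Ψ, hinv]

theorem mapsTo_inner_or_mapsTo_outer (h : IsAnnularChart K Ψ r R)
    (hS : IsUnionOfComponents S Kᶜ) (hne : S.Nonempty) :
    MapsTo Ψ (annulus r 1) S ∨ MapsTo Ψ (annulus 1 R) S := by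
  have mapsTo_of_mem : ∀ {V : Set ℂ}, IsPreconnected V → V ⊆ annulus r R →
      (∀ z ∈ V, ‖z‖ ≠ 1) → (∃ z ∈ V, Ψ z ∈ S) → MapsTo Ψ V S := by
    rintro V hV hVA hV1 ⟨z, hzV, hzS⟩
    refine mapsTo_iff_image_subset.2 (hS.subset_of_isPreconnected
      (hV.image Ψ (h.differentiableOn.continuousOn.mono hVA)) ?_
      ⟨Ψ z, mem_image_of_mem Ψ hzV, hzS⟩)
    rintro _ ⟨w, hw, rfl⟩
    exact fun hwK => hV1 w hw ((h.mem_curve_iff (hVA hw)).1 hwK)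
  obtain ⟨_, ⟨z, hz, rfl⟩, hzS⟩ := hS.inter_nonempty_of_subset_isOpen h.isCompact.isClosed
    h.nonempty hne h.isOpen_image h.subset_image
  rcases lt_trichotomy ‖z‖ 1 with hz1 | hz1 | hz1
  · exact .inl (mapsTo_of_mem (isPreconnected_annulus h.r_pos.le) h.inner_subset
      (fun w hw => hw.2.ne) ⟨z, ⟨hz.1, hz1⟩, hzS⟩)
  · exact absurd ((h.mem_curve_iff hz).2 hz1) (hS.1 hzS)
  · exact .inr (mapsTo_of_mem (isPreconnected_annulus zero_le_one) h.outer_subset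
      (fun w hw => hw.1.ne') ⟨z, ⟨hz1, hz.2⟩, hzS⟩)

end IsAnnularChart

/-- `Ψ` is an annular chart around `K` in which the open set `S` off `K` is seen as the inner part
of the annulus. -/
structure IsCollar (K S : Set ℂ) (Ψ : ℂ → ℂ) (r R : ℝ) : Prop extends
    IsAnnularChart K Ψ r R where
  subset_compl : S ⊆ Kᶜ
  mapsTo_inner : MapsTo Ψ (annulus r 1) S
  mapsTo_outer : MapsTo Ψ (annulus 1 R) Sᶜ

namespace IsAnnularChart

variable {K S T : Set ℂ} {Ψ : ℂ → ℂ} {r R : ℝ}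

theorem isCollar (h : IsAnnularChart K Ψ r R) (hS : S ⊆ Kᶜ) (hT : IsUnionOfComponents T Kᶜ)
    (hST : Disjoint S T) (hTne : T.Nonempty) (hinner : MapsTo Ψ (annulus r 1) S) :
    IsCollar K S Ψ r R where
  toIsAnnularChart := h
  subset_compl := hS
  mapsTo_inner := hinner
  mapsTo_outer := by
    rcases h.mapsTo_inner_or_mapsTo_outer hT hTne with hTi | hTo
    · obtain ⟨z, hz⟩ := annulus_nonempty h.r_pos.le h.r_lt_one
      exact absurd (hTi hz) (disjoint_left.1 hST (hinner hz))
    · exact fun z hz => disjoint_right.1 hST (hTo hz)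

theorem exists_isCollar (h : IsAnnularChart K Ψ r R) (hS : IsUnionOfComponents S Kᶜ)
    (hT : IsUnionOfComponents T Kᶜ) (hST : Disjoint S T) (hSne : S.Nonempty) (hTne : T.Nonempty) :
    ∃ Ψ r R, IsCollar K S Ψ r R := by
  rcases h.mapsTo_inner_or_mapsTo_outer hS hSne with hinner | houter
  · exact ⟨Ψ, r, R, h.isCollar hS.1 hT hST hTne hinner⟩
  · refine ⟨_, _, _, h.inv.isCollar hS.1 hT hST hTne fun z hz => houter ?_⟩
    exact inv_mem_annulus zero_lt_one (zero_lt_one.trans h.one_lt_R) (by rwa [inv_one])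

end IsAnnularChart

namespace IsCollar

variable {K S : Set ℂ} {Ψ : ℂ → ℂ} {r R : ℝ}

theorem mem_side_iff (h : IsCollar K S Ψ r R) {z : ℂ} (hz : z ∈ annulus r R) :
    Ψ z ∈ S ↔ ‖z‖ < 1 := by
  refine ⟨fun hzS => lt_of_not_ge fun hz1 => ?_, fun hz1 => h.mapsTo_inner ⟨hz.1, hz1⟩⟩
  rcases hz1.eq_or_lt with hz1 | hz1
  · exact h.subset_compl hzS ((h.mem_curve_iff hz).2 hz1.symm)
  · exact h.mapsTo_outer ⟨hz1, hz.2⟩ hzS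

theorem subset_frontier (h : IsCollar K S Ψ r R) : K ⊆ frontier S := by
  intro p hp
  refine ⟨?_, fun hpS => h.subset_compl (interior_subset hpS) hp⟩
  rw [← h.image_sphere] at hp
  obtain ⟨ζ, hζ, rfl⟩ := hp
  have := nhdsWithin_ball_neBot hζ
  exact mem_closure_of_tendsto
    ((h.differentiableOn.continuousOn.continuousAt
      ((isOpen_annulus r R).mem_nhds (h.sphere_subset hζ))).tendsto.mono_left nhdsWithin_le_nhds)
    (mem_of_superset (nhdsWithin_ball_le_innerCircle hζ
      (hasBasis_innerCircle.mem_of_mem h.r_lt_one)) h.mapsTo_inner)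

theorem tendsto_innerCircle (h : IsCollar K S Ψ r R) : Tendsto Ψ innerCircle (𝓝ˢ[S] K) := by
  refine tendsto_inf.2 ⟨?_, tendsto_principal.2
    (mem_of_superset (hasBasis_innerCircle.mem_of_mem h.r_lt_one) h.mapsTo_inner)⟩
  rw [innerCircle_eq]
  exact (h.differentiableOn.continuousOn.tendsto_nhdsSet
    ((isOpen_annulus r R).mem_nhdsSet.2 h.sphere_subset) h.mapsTo_sphere).mono_left inf_le_left

theorem image_mem_nhdsSetWithin (h : IsCollar K S Ψ r R) : Ψ '' annulus r R ∈ 𝓝ˢ[S] K :=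
  mem_inf_of_left (h.isOpen_image.mem_nhdsSet.2 h.subset_image)

theorem tendsto_invFunOn (h : IsCollar K S Ψ r R) :
    Tendsto (Function.invFunOn Ψ (annulus r R)) (𝓝ˢ[S] K) innerCircle := by
  have hinv : LeftInvOn (Function.invFunOn Ψ (annulus r R)) Ψ (annulus r R) :=
    h.injOn.leftInvOn_invFunOn
  have hmaps : MapsTo (Function.invFunOn Ψ (annulus r R)) K (sphere 0 1) := by
    rw [← h.image_sphere]
    rintro _ ⟨z, hz, rfl⟩
    rwa [hinv (h.sphere_subset hz)]
  rw [innerCircle_eq]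
  refine tendsto_inf.2 ⟨((differentiableOn_invFunOn (isOpen_annulus r R) h.differentiableOn
    h.injOn).continuousOn.tendsto_nhdsSet (h.isOpen_image.mem_nhdsSet.2 h.subset_image)
    hmaps).mono_left inf_le_left, tendsto_principal.2 ?_⟩
  filter_upwards [h.image_mem_nhdsSetWithin, mem_inf_of_right (mem_principal_self S)]
  rintro _ ⟨z, hz, rfl⟩ hzS
  rw [hinv hz, mem_ball_zero_iff]
  exact (h.mem_side_iff hz).1 hzS

theorem eventually_differentiableAt_invFunOn (h : IsCollar K S Ψ r R) :
    ∀ᶠ p in 𝓝ˢ[S] K, DifferentiableAt ℂ (Function.invFunOn Ψ (annulus r R)) p :=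
  mem_of_superset h.image_mem_nhdsSetWithin fun _ hp =>
    (differentiableOn_invFunOn (isOpen_annulus r R) h.differentiableOn h.injOn).differentiableAt
      (h.isOpen_image.mem_nhds hp)

end IsCollar

end Charts

section BoundaryValues

variable {K Ω : Set ℂ} {φ Ψ : ℂ → ℂ} {r R : ℝ}

namespace IsRiemannMap

theorem isOpen (hφ : IsRiemannMap φ Ω) : IsOpen Ω :=
  hφ.2.image_eq ▸ isOpen_image_of_injOn isOpen_ball hφ.1 hφ.2.injOn

theorem differentiableOn_invFunOn (hφ : IsRiemannMap φ Ω) :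
    DifferentiableOn ℂ (Function.invFunOn φ (ball 0 1)) Ω :=
  hφ.2.image_eq ▸ JordanCurve.differentiableOn_invFunOn isOpen_ball hφ.1 hφ.2.injOn

theorem tendsto_innerCircle (hφ : IsRiemannMap φ Ω) (hΩ : Bornology.IsBounded Ω) :
    Tendsto φ innerCircle (𝓝ˢ[Ω] (frontier Ω)) := by
  rw [innerCircle_eq, ← frontier_ball 0 one_ne_zero]
  exact tendsto_nhdsSetWithin_frontier isOpen_ball isBounded_ball.isCompact_closure hφ.isOpen
    hΩ.isCompact_closure hφ.2.mapsTo hφ.2.surjOn.mapsTo_invFunOn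
    hφ.differentiableOn_invFunOn.continuousOn hφ.2.injOn.leftInvOn_invFunOn

theorem tendsto_invFunOn (hφ : IsRiemannMap φ Ω) (hΩ : Bornology.IsBounded Ω) :
    Tendsto (Function.invFunOn φ (ball 0 1)) (𝓝ˢ[Ω] (frontier Ω)) innerCircle := by
  rw [innerCircle_eq, ← frontier_ball 0 one_ne_zero]
  exact tendsto_nhdsSetWithin_frontier hφ.isOpen hΩ.isCompact_closure isOpen_ball
    isBounded_ball.isCompact_closure hφ.2.surjOn.mapsTo_invFunOn hφ.2.mapsTo
    hφ.1.continuousOn hφ.2.surjOn.rightInvOn_invFunOn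

theorem exists_boundary_correspondence (hφ : IsRiemannMap φ Ω) (hΩ : Bornology.IsBounded Ω)
    (hK : frontier Ω = K) (hC : IsCollar K Ω Ψ r R) :
    ∃ τ : ℂ → ℂ, BijOn τ (sphere 0 1) (sphere 0 1) ∧
      ∀ ζ ∈ sphere (0 : ℂ) 1, Tendsto φ (𝓝[ball 0 1] ζ) (𝓝 (Ψ (τ ζ))) := by
  set ψ := Function.invFunOn φ (ball 0 1)
  set g := Function.invFunOn Ψ (annulus r R)
  have hφt : Tendsto φ innerCircle (𝓝ˢ[Ω] K) := hK ▸ hφ.tendsto_innerCircle hΩ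
  have hψt : Tendsto ψ (𝓝ˢ[Ω] K) innerCircle := hK ▸ hφ.tendsto_invFunOn hΩ
  have hΩm : Ω ∈ 𝓝ˢ[Ω] K := mem_inf_of_right (mem_principal_self Ω)
  have hinner : annulus r R ∈ innerCircle := annulus_mem_innerCircle hC.r_lt_one hC.one_lt_R
  have hψφ : LeftInvOn ψ φ (ball 0 1) := hφ.2.injOn.leftInvOn_invFunOn
  have hφψ : RightInvOn ψ φ Ω := hφ.2.surjOn.rightInvOn_invFunOn
  have hgΨ : LeftInvOn g Ψ (annulus r R) := hC.injOn.leftInvOn_invFunOn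
  have hΨg : ∀ p ∈ Ψ '' annulus r R, Ψ (g p) = p := fun p hp => Function.invFunOn_eq hp
  obtain ⟨τ, hτ, hlim⟩ := exists_bijOn_sphere_tendsto (f := g ∘ φ) (g := ψ ∘ Ψ)
    (by
      filter_upwards [ball_zero_mem_innerCircle,
        hφt.eventually hC.eventually_differentiableAt_invFunOn] with z hz hgz
      exact hgz.comp z (hφ.1.differentiableAt (isOpen_ball.mem_nhds hz)))
    (by
      filter_upwards [hinner, hC.tendsto_innerCircle.eventually hΩm] with z hz hzΩ
      exact (hφ.differentiableOn_invFunOn.differentiableAt (hφ.isOpen.mem_nhds hzΩ)).comp z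
        (hC.differentiableOn.differentiableAt ((isOpen_annulus r R).mem_nhds hz)))
    (hC.tendsto_invFunOn.comp hφt) (hψt.comp hC.tendsto_innerCircle)
    (by
      filter_upwards [ball_zero_mem_innerCircle, hφt.eventually hC.image_mem_nhdsSetWithin]
        with z hz hφz
      rw [Function.comp_apply, Function.comp_apply, hΨg _ hφz, hψφ hz])
    (by
      filter_upwards [hinner, hC.tendsto_innerCircle.eventually hΩm] with z hz hzΩ
      rw [Function.comp_apply, Function.comp_apply, hφψ hzΩ, hgΨ hz])
  refine ⟨τ, hτ, fun ζ hζ => ?_⟩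
  have hΨτ : Tendsto Ψ (𝓝 (τ ζ)) (𝓝 (Ψ (τ ζ))) := hC.differentiableOn.continuousOn.continuousAt
    ((isOpen_annulus r R).mem_nhds (hC.sphere_subset (hτ.mapsTo hζ)))
  refine (hΨτ.comp (hlim ζ hζ)).congr' (nhdsWithin_ball_le_innerCircle hζ ?_)
  filter_upwards [hφt.eventually hC.image_mem_nhdsSetWithin] with z hz using hΨg _ hz

theorem exists_circle_homeomorph (hφ : IsRiemannMap φ Ω) (hΩ : Bornology.IsBounded Ω)
    (hK : frontier Ω = K) (hC : IsCollar K Ω Ψ r R) :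
    trace φ = K ∧ ∃ e : Circle ≃ₜ trace φ,
      ∀ θ : ℝ, e (Circle.exp θ) = ⟨boundaryCurve φ θ, mem_range_self θ⟩ := by
  obtain ⟨τ, hτ, hlim⟩ := hφ.exists_boundary_correspondence hΩ hK hC
  have hclosure : sphere (0 : ℂ) 1 ⊆ closure (ball 0 1) := by
    rw [closure_ball _ one_ne_zero]
    exact sphere_subset_closedBall
  set f := extendFrom (ball (0 : ℂ) 1) φ
  have hfτ : EqOn f (Ψ ∘ τ) (sphere 0 1) := fun ζ hζ => extendFrom_eq (hclosure hζ) (hlim ζ hζ)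
  have hfc : ContinuousOn f (sphere 0 1) :=
    continuousOn_extendFrom hclosure fun ζ hζ => ⟨_, hlim ζ hζ⟩
  have hfi : InjOn f (sphere 0 1) :=
    ((hC.injOn.mono hC.sphere_subset).comp hτ.injOn hτ.mapsTo).congr hfτ.symm
  have htrace : range (fun ζ : Circle => f ζ) = trace φ :=
    (Circle.exp_surjective.range_comp fun ζ : Circle => f ζ).symm
  have hemb : IsClosedEmbedding fun ζ : Circle => f ζ :=
    Continuous.isClosedEmbedding (hfc.comp_continuous continuous_subtype_val fun ζ => ζ.2)
      fun ζ ξ h => Circle.ext (hfi ζ.2 ξ.2 h)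
  refine ⟨?_, hemb.isEmbedding.toHomeomorph.trans (Homeomorph.setCongr htrace), fun θ => rfl⟩
  have himage : range (fun ζ : Circle => f ζ) = f '' sphere 0 1 :=
    (range_comp f _).trans (congrArg (f '' ·) Subtype.range_coe)
  rw [← htrace, himage, hfτ.image_eq, image_comp, hτ.image_eq, hC.image_sphere]

end IsRiemannMap

end BoundaryValues

theorem extendsAt_of_continuousOn_ball {K S : Set ℂ} {u : K → ℂ} (hu : Continuous u) {z₀ : ℂ}
    {ρ : ℝ} (hρ : 0 < ρ) {F : ℂ → ℂ} (hFc : ContinuousOn F (ball z₀ ρ ∩ (K ∪ S)))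
    (hFd : DifferentiableOn ℂ F (ball z₀ ρ ∩ S))
    (hFu : ∀ z : K, (z : ℂ) ∈ ball z₀ ρ → F z = u z) : ExtendsAt K S u z₀ := by
  set H : ℂ → ℂ := Function.extend Subtype.val u F
  have hHu : ∀ z : K, H z = u z := Subtype.val_injective.extend_apply u F
  have hHF : EqOn H F (ball z₀ ρ) := by
    intro z hz
    by_cases hzK : z ∈ K
    · exact (hHu ⟨z, hzK⟩).trans (hFu ⟨z, hzK⟩ hz).symm
    · exact Function.extend_apply' u F z (by simpa using hzK)
  have hHK : ContinuousOn H K := by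
    rw [continuousOn_iff_continuous_domRestrict]
    exact hu.congr fun z => (hHu z).symm
  have hball : ball z₀ (ρ / 2) ⊆ ball z₀ ρ := ball_subset_ball (half_le_self hρ.le)
  refine ⟨ρ / 2, half_pos hρ, H, fun z hz => ?_, ?_, fun z _ => hHu z⟩
  · by_cases hzρ : z ∈ ball z₀ ρ
    · have hHc : ContinuousOn H (ball z₀ ρ ∩ (K ∪ S)) := hFc.congr (hHF.mono inter_subset_left)
      refine (hHc z ⟨hzρ, hz.imp_right And.right⟩).mono_of_mem_nhdsWithin ?_
      exact inter_mem (mem_nhdsWithin_of_mem_nhds (isOpen_ball.mem_nhds hzρ))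
        (mem_of_superset self_mem_nhdsWithin (union_subset_union_right K inter_subset_right))
    · have hzK : z ∈ K := hz.resolve_right fun hzS => hzρ (hball hzS.1)
      refine (hHK z hzK).mono_of_mem_nhdsWithin ?_
      filter_upwards [self_mem_nhdsWithin, mem_nhdsWithin_of_mem_nhds
        (isClosed_closedBall.isOpen_compl.mem_nhds fun hz' =>
          hzρ (closedBall_subset_ball (half_lt_self hρ) hz'))] with p hp hpρ
      exact hp.resolve_right fun hpS => hpρ (ball_subset_closedBall hpS.1)
  · exact (hFd.mono (inter_subset_inter_left S hball)).congr
      (hHF.mono (inter_subset_left.trans hball))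

/-- `E` is a holomorphic coordinate on the disc of centre `t` and radius `b` in which `K` is seen
as the real axis and `S` as the upper half plane. -/
structure IsFlattening (K S : Set ℂ) (E : ℂ → ℂ) (t b : ℝ) : Prop where
  pos : 0 < b
  differentiableOn : DifferentiableOn ℂ E (ball t b)
  injOn : InjOn E (ball t b)
  mem_curve_iff : ∀ w ∈ ball (t : ℂ) b, E w ∈ K ↔ w.im = 0
  mem_side_iff : ∀ w ∈ ball (t : ℂ) b, E w ∈ S ↔ 0 < w.im

namespace IsFlattening

variable {K S : Set ℂ} {E : ℂ → ℂ} {t a b : ℝ} {u : K → ℂ} {v : ℝ → ℂ}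

theorem mono (h : IsFlattening K S E t b) (ha : 0 < a) (hab : a ≤ b) :
    IsFlattening K S E t a where
  pos := ha
  differentiableOn := h.differentiableOn.mono (ball_subset_ball hab)
  injOn := h.injOn.mono (ball_subset_ball hab)
  mem_curve_iff w hw := h.mem_curve_iff w (ball_subset_ball hab hw)
  mem_side_iff w hw := h.mem_side_iff w (ball_subset_ball hab hw)

theorem isOpen_image (h : IsFlattening K S E t b) : IsOpen (E '' ball t b) :=
  isOpen_image_of_injOn isOpen_ball h.differentiableOn h.injOn

theorem exists_isHalfDiscExtension (h : IsFlattening K S E t b)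
    (hv : ∀ (x : ℝ) hx, u ⟨E x, hx⟩ = v x) (hu : ExtendsAt K S u (E t)) :
    ∃ a > 0, ∃ G, IsHalfDiscExtension v t a G := by
  obtain ⟨ρ, hρ, F, hFc, hFd, hFu⟩ := hu
  have hE : ContinuousAt E t := h.differentiableOn.continuousOn.continuousAt
    (ball_mem_nhds _ h.pos)
  obtain ⟨a, ha, hball⟩ := Metric.eventually_nhds_iff_ball.1
    (inter_mem (ball_mem_nhds (t : ℂ) h.pos) (hE (ball_mem_nhds _ hρ)))
  have hab : ball (t : ℂ) a ⊆ ball (t : ℂ) b := fun w hw => (hball w hw).1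
  refine ⟨a, ha, F ∘ E, ?_, ?_, fun x hx => ?_⟩
  · refine hFc.comp (h.differentiableOn.continuousOn.mono (inter_subset_left.trans hab))
      fun w ⟨hw, him⟩ => ?_
    rcases (show 0 ≤ w.im from him).eq_or_lt with him | him
    · exact .inl ((h.mem_curve_iff w (hab hw)).2 him.symm)
    · exact .inr ⟨(hball w hw).2, (h.mem_side_iff w (hab hw)).2 him⟩
  · exact hFd.comp (h.differentiableOn.mono (inter_subset_left.trans hab)) fun w hw =>
      ⟨(hball w hw.1).2, (h.mem_side_iff w (hab hw.1)).2 hw.2⟩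
  · have hxa := (ofReal_mem_closedHalfDisc hx).1
    have hxK := (h.mem_curve_iff x (hab hxa)).2 (Complex.ofReal_im x)
    exact (hFu ⟨E x, hxK⟩ (hball x hxa).2).trans (hv x hxK)

theorem extendsAt (h : IsFlattening K S E t b) (hu : Continuous u)
    (hv : ∀ (x : ℝ) hx, u ⟨E x, hx⟩ = v x) {G : ℂ → ℂ} (hG : IsHalfDiscExtension v t b G) :
    ExtendsAt K S u (E t) := by
  set g := Function.invFunOn E (ball (t : ℂ) b)
  have hg : DifferentiableOn ℂ g (E '' ball (t : ℂ) b) :=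
    differentiableOn_invFunOn isOpen_ball h.differentiableOn h.injOn
  have hgE : ∀ w ∈ ball (t : ℂ) b, g (E w) = w := h.injOn.leftInvOn_invFunOn
  obtain ⟨ρ, hρ, hρE⟩ := Metric.isOpen_iff.1 h.isOpen_image (E t)
    (mem_image_of_mem E (mem_ball_self h.pos))
  refine extendsAt_of_continuousOn_ball hu hρ (F := G ∘ g) ?_ ?_ ?_
  · refine hG.continuousOn.comp (hg.continuousOn.mono (inter_subset_left.trans hρE)) ?_
    rintro _ ⟨hp, hpKS⟩
    obtain ⟨w, hw, rfl⟩ := hρE hp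
    rw [hgE w hw]
    exact ⟨hw, hpKS.elim (fun hK => ((h.mem_curve_iff w hw).1 hK).ge)
      fun hS => ((h.mem_side_iff w hw).1 hS).le⟩
  · refine hG.differentiableOn.comp (hg.mono (inter_subset_left.trans hρE)) ?_
    rintro _ ⟨hp, hpS⟩
    obtain ⟨w, hw, rfl⟩ := hρE hp
    rw [hgE w hw]
    exact ⟨hw, (h.mem_side_iff w hw).1 hpS⟩
  · rintro ⟨z, hzK⟩ hz
    obtain ⟨w, hw, rfl⟩ := hρE hz
    obtain ⟨x, rfl⟩ : ∃ x : ℝ, (x : ℂ) = w :=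
      ⟨w.re, Complex.ext rfl ((h.mem_curve_iff w hw).1 hzK).symm⟩
    have hx : x ∈ ball t b := by rwa [mem_ball, Complex.isometry_ofReal.dist_eq] at hw
    rw [Function.comp_apply, hgE x hw, hG.eqOn x hx, hv x hzK]

end IsFlattening

namespace IsCollar

variable {K S : Set ℂ} {Ψ : ℂ → ℂ} {r R : ℝ}

/-- The parametrization of `K` by the angle in the annulus of a collar. -/
noncomputable def param (h : IsCollar K S Ψ r R) (t : ℝ) : K :=
  ⟨Ψ (Complex.exp (t * Complex.I)),
    h.mapsTo_sphere (mem_sphere_zero_iff_norm.2 (Complex.norm_exp_ofReal_mul_I t))⟩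

theorem continuous_param (h : IsCollar K S Ψ r R) : Continuous h.param :=
  .subtype_mk (h.continuousOn_sphere.comp_continuous (by fun_prop) fun t =>
    mem_sphere_zero_iff_norm.2 (Complex.norm_exp_ofReal_mul_I t)) _

theorem surjective_param (h : IsCollar K S Ψ r R) : Function.Surjective h.param := by
  rintro ⟨z, hz⟩
  rw [← h.image_sphere] at hz
  obtain ⟨ζ, hζ, rfl⟩ := hz
  obtain ⟨t, ht⟩ := Circle.exp_surjective ⟨ζ, hζ⟩
  exact ⟨t, Subtype.ext (congrArg Ψ (congrArg Subtype.val ht))⟩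

theorem exists_isFlattening (h : IsCollar K S Ψ r R) (t : ℝ) :
    ∃ b, IsFlattening K S (fun w => Ψ (Complex.exp (w * Complex.I))) t b := by
  have hexp : Differentiable ℂ fun w : ℂ => Complex.exp (w * Complex.I) := by fun_prop
  have hnorm : ∀ w : ℂ, ‖Complex.exp (w * Complex.I)‖ = Real.exp (-w.im) := fun w => by
    simp [Complex.norm_exp]
  obtain ⟨V, hV, hVi⟩ := isLocallyInjective_iff_nhds.1
    Complex.isCoveringMap_exp.isLocalHomeomorph.isLocallyInjective (t * Complex.I)
  have hVt : ∀ᶠ w in 𝓝 (t : ℂ), w * Complex.I ∈ V :=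
    (continuous_mul_const Complex.I).continuousAt.preimage_mem_nhds hV
  have hAt : ∀ᶠ w in 𝓝 (t : ℂ), Complex.exp (w * Complex.I) ∈ annulus r R :=
    hexp.continuous.continuousAt.preimage_mem_nhds ((isOpen_annulus r R).mem_nhds
      (h.sphere_subset (mem_sphere_zero_iff_norm.2 (Complex.norm_exp_ofReal_mul_I t))))
  obtain ⟨b, hb, hball⟩ := Metric.eventually_nhds_iff_ball.1 (hVt.and hAt)
  refine ⟨b, hb, h.differentiableOn.comp hexp.differentiableOn fun w hw => (hball w hw).2,
    fun w hw z hz hwz => ?_, fun w hw => ?_, fun w hw => ?_⟩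
  · exact mul_right_cancel₀ Complex.I_ne_zero (hVi (hball w hw).1 (hball z hz).1
      (Subtype.ext (h.injOn (hball w hw).2 (hball z hz).2 hwz)))
  · rw [h.mem_curve_iff (hball w hw).2, hnorm, Real.exp_eq_one_iff, neg_eq_zero]
  · rw [h.mem_side_iff (hball w hw).2, hnorm, Real.exp_lt_one_iff, neg_lt_zero]

theorem exists_param_ne (h : IsCollar K S Ψ r R) (t : ℝ) {a : ℝ} (ha : 0 < a) :
    ∃ s ∈ ball t a, h.param s ≠ h.param t := by
  obtain ⟨b, hb⟩ := h.exists_isFlattening t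
  obtain ⟨c, hc, hcab⟩ := exists_between (lt_min ha hb.pos)
  have hdist : dist (t + c) t = c := by simp [abs_of_pos hc]
  refine ⟨t + c, by rw [mem_ball, hdist]; exact hcab.trans_le (min_le_left a b), fun heq => ?_⟩
  have hmem : ((t + c : ℝ) : ℂ) ∈ ball (t : ℂ) b := by
    rw [mem_ball, Complex.isometry_ofReal.dist_eq, hdist]
    exact hcab.trans_le (min_le_right a b)
  have := Complex.ofReal_injective
    (hb.injOn hmem (mem_ball_self hb.pos) (congrArg Subtype.val heq))
  linarith

theorem exists_isHalfDiscExtension (h : IsCollar K S Ψ r R) {u : K → ℂ} {t : ℝ}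
    (hu : ExtendsAt K S u (h.param t)) : ∃ a > 0, ∃ G, IsHalfDiscExtension (u ∘ h.param) t a G :=
  let ⟨_, hb⟩ := h.exists_isFlattening t
  hb.exists_isHalfDiscExtension (fun _ _ => rfl) hu

theorem extendsAt (h : IsCollar K S Ψ r R) {u : K → ℂ} (hu : Continuous u) {t a : ℝ}
    (ha : 0 < a) {G : ℂ → ℂ} (hG : IsHalfDiscExtension (u ∘ h.param) t a G) :
    ExtendsAt K S u (h.param t) := by
  obtain ⟨b, hb⟩ := h.exists_isFlattening t
  have hab : 0 < min a b := lt_min ha hb.pos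
  exact (hb.mono hab (min_le_right a b)).extendsAt hu (fun _ _ => rfl)
    (hG.mono (by rw [dist_self, zero_add]; exact min_le_left a b))

end IsCollar

section UniformLimits

variable {ι E : Type*} [NormedAddCommGroup E] [NormedSpace ℝ E] {p : Filter ι} [p.NeBot]
  {k : ℕ∞} {f : ι → ℝ → E} {G : {l : ℕ // (l : ℕ∞) ≤ k} → ℝ → E}

theorem hasDerivAt_of_tendstoUniformly_iteratedDeriv (hf : ∀ i, ContDiff ℝ k (f i))
    (hG : ∀ l, TendstoUniformly (fun i => iteratedDeriv l.1 (f i)) (G l) p)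
    {l : ℕ} (hl : (l : ℕ∞) < k) (x : ℝ) :
    HasDerivAt (G ⟨l, hl.le⟩) (G ⟨l + 1, Order.add_one_le_of_lt hl⟩ x) x := by
  refine hasDerivAt_of_tendstoUniformly (hG ⟨l + 1, _⟩) (.of_forall fun i y => ?_)
    (fun y => (hG ⟨l, hl.le⟩).tendsto_at y) x
  rw [iteratedDeriv_succ]
  exact ((hf i).differentiable_iteratedDeriv l (by exact_mod_cast hl) y).hasDerivAt

theorem iteratedDeriv_eq_of_tendstoUniformly (hf : ∀ i, ContDiff ℝ k (f i))
    (hG : ∀ l, TendstoUniformly (fun i => iteratedDeriv l.1 (f i)) (G l) p)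
    {l : ℕ} (hl : (l : ℕ∞) ≤ k) : iteratedDeriv l (G ⟨0, zero_le⟩) = G ⟨l, hl⟩ := by
  induction l with
  | zero => exact iteratedDeriv_zero
  | succ l ih =>
    have hlk : (l : ℕ∞) < k := lt_of_lt_of_le (by exact_mod_cast l.lt_succ_self) hl
    funext x
    rw [iteratedDeriv_succ, ih hlk.le]
    exact (hasDerivAt_of_tendstoUniformly_iteratedDeriv hf hG hlk x).deriv

theorem contDiff_of_tendstoUniformly_iteratedDeriv (hf : ∀ i, ContDiff ℝ k (f i))
    (hG : ∀ l, TendstoUniformly (fun i => iteratedDeriv l.1 (f i)) (G l) p) :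
    ContDiff ℝ k (G ⟨0, zero_le⟩) := by
  refine contDiff_iff_iteratedDeriv.2 ⟨fun l hl => ?_, fun l hl x => ?_⟩
  · rw [iteratedDeriv_eq_of_tendstoUniformly hf hG hl]
    exact (hG ⟨l, hl⟩).continuous (.of_forall fun i =>
      (hf i).continuous_iteratedDeriv l (by exact_mod_cast hl))
  · rw [iteratedDeriv_eq_of_tendstoUniformly hf hG hl.le]
    exact (hasDerivAt_of_tendstoUniformly_iteratedDeriv hf hG hl x).differentiableAt

end UniformLimits

section CkSpaces

open scoped BoundedContinuousFunction

variable {φ : ℂ → ℂ} {k : ℕ∞}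

theorem tendstoUniformly_pullback_iff {ι : Type*} {p : Filter ι} {f : ι → trace φ → ℂ}
    {g : trace φ → ℂ} :
    TendstoUniformly (fun i => pullback φ (f i)) (pullback φ g) p ↔ TendstoUniformly f g p := by
  simp only [Metric.tendstoUniformly_iff, pullback]
  refine forall₂_congr fun ε _ => eventually_congr (.of_forall fun i => ⟨?_, fun h θ => h _⟩)
  rintro h ⟨_, θ, rfl⟩
  exact h θ

instance : Nonempty {l : ℕ // (l : ℕ∞) ≤ k} := ⟨⟨0, zero_le⟩⟩

theorem withSeminorms_ckSeminorm (φ : ℂ → ℂ) (k : ℕ∞) : WithSeminorms (ckSeminorm φ k) := ⟨rfl⟩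

instance : IsTopologicalAddGroup (Ck φ k) := (withSeminorms_ckSeminorm φ k).topologicalAddGroup

instance : ContinuousSMul ℂ (Ck φ k) := (withSeminorms_ckSeminorm φ k).continuousSMul

namespace Ck

/-- The derivatives of `θ ↦ u (φ (e^{iθ}))` of the finite orders `l ≤ k`, as bounded functions. -/
noncomputable def jet (u : Ck φ k) (l : {l : ℕ // (l : ℕ∞) ≤ k}) : ℝ →ᵇ ℂ :=
  .ofNormedAddCommGroup (iteratedDeriv l.1 (pullback φ u.toFun))
    ((u.contDiff l.2).continuous_iteratedDeriv l.1 le_rfl) _ (le_ciSup (u.bddAbove l.2))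

theorem dist_jet (u v : Ck φ k) (l : {l : ℕ // (l : ℕ∞) ≤ k}) :
    dist (u.jet l) (v.jet l) = ckSeminorm φ k l (u - v) := by
  rw [BoundedContinuousFunction.dist_eq_iSup]
  refine iSup_congr fun θ => ?_
  have hsub : pullback φ (u - v).toFun = pullback φ u.toFun - pullback φ v.toFun := rfl
  rw [hsub, iteratedDeriv_sub (u.contDiff l.2).contDiffAt (v.contDiff l.2).contDiffAt]
  exact dist_eq_norm _ _

theorem tendsto_nhds_iff_jet {ι : Type*} {p : Filter ι} {f : ι → Ck φ k} {u : Ck φ k} :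
    Tendsto f p (𝓝 u) ↔ Tendsto (fun i => (f i).jet) p (𝓝 u.jet) := by
  simp only [(withSeminorms_ckSeminorm φ k).tendsto_nhds, tendsto_pi_nhds, Metric.tendsto_nhds,
    dist_jet, gt_iff_lt]

theorem tendstoUniformly_toFun {ι : Type*} {p : Filter ι} {f : ι → Ck φ k} {u : Ck φ k}
    (hf : Tendsto f p (𝓝 u)) : TendstoUniformly (fun i => (f i).toFun) u.toFun p :=
  tendstoUniformly_pullback_iff.1 <| BoundedContinuousFunction.tendsto_iff_tendstoUniformly.1 <|
    tendsto_pi_nhds.1 (tendsto_nhds_iff_jet.1 hf) ⟨0, zero_le⟩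

theorem isInducing_jet : IsInducing (jet : Ck φ k → _) :=
  isInducing_iff_nhds.2 fun _ => eq_of_forall_le_iff fun _ =>
    tendsto_nhds_iff_jet.trans tendsto_iff_comap

theorem continuous_toFun (u : Ck φ k) : Continuous u.toFun := (Subtype.prop u).1

theorem jet_injective : Function.Injective (jet : Ck φ k → _) := by
  intro u v h
  refine Subtype.ext (funext ?_)
  rintro ⟨_, θ, rfl⟩
  exact DFunLike.congr_fun (congrFun h ⟨0, zero_le⟩) θ

theorem isClosed_range_jet : IsClosed (range (jet : Ck φ k → _)) := by
  refine isClosed_of_closure_subset fun y hy => ?_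
  obtain ⟨x, hx, hxy⟩ := mem_closure_iff_seq_limit.1 hy
  choose u hu using hx
  have hlim (l) : TendstoUniformly (fun n => iteratedDeriv l.1 (pullback φ (u n).toFun)) (y l)
      atTop := BoundedContinuousFunction.tendsto_iff_tendstoUniformly.1
    (by simpa only [← hu] using tendsto_pi_nhds.1 hxy l)
  have hlim₀ : TendstoUniformly (fun n => pullback φ (u n).toFun) (y ⟨0, zero_le⟩) atTop :=
    hlim ⟨0, zero_le⟩
  choose angle hangle using fun z : trace φ => z.2
  have hpull : pullback φ (y ⟨0, zero_le⟩ ∘ angle) = y ⟨0, zero_le⟩ := by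
    refine funext fun θ => tendsto_nhds_unique (hlim₀.tendsto_at _) ?_
    refine (hlim₀.tendsto_at θ).congr fun n => congrArg (u n).toFun (Subtype.ext ?_)
    exact (hangle ⟨boundaryCurve φ θ, mem_range_self θ⟩).symm
  have hcont : Continuous (y ⟨0, zero_le⟩ ∘ angle) :=
    (tendstoUniformly_pullback_iff.1 (hpull ▸ hlim₀)).continuous
      (.of_forall fun n => (u n).continuous_toFun)
  have hu_contDiff (n) : ContDiff ℝ k (pullback φ (u n).toFun) := (Subtype.prop (u n)).2
  refine ⟨⟨y ⟨0, zero_le⟩ ∘ angle, hcont, ?_⟩, funext fun l => DFunLike.coe_injective ?_⟩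
  · rw [hpull]
    exact contDiff_of_tendstoUniformly_iteratedDeriv hu_contDiff hlim
  · change iteratedDeriv l.1 (pullback φ (y ⟨0, zero_le⟩ ∘ angle)) = y l
    rw [hpull, iteratedDeriv_eq_of_tendstoUniformly hu_contDiff hlim l.2]

instance : BaireSpace (Ck φ k) :=
  have : IsClosedEmbedding (jet : Ck φ k → _) :=
    ⟨⟨isInducing_jet, jet_injective⟩, isClosed_range_jet⟩
  have := this.IsCompletelyMetrizableSpace
  inferInstance

end Ck

end CkSpaces

theorem dense_iInter_compl_closure {𝕜 E ι : Type*} [NontriviallyNormedField 𝕜] [AddCommGroup E]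
    [Module 𝕜 E] [TopologicalSpace E] [ContinuousAdd E] [ContinuousSMul 𝕜 E] [BaireSpace E]
    [Countable ι] {P : ι → Set E} (Q : ι → Submodule 𝕜 E) (hPQ : ∀ i, closure (P i) ⊆ Q i)
    (hQ : ∀ i, Q i ≠ ⊤) : Dense (⋂ i, (closure (P i))ᶜ) := by
  refine dense_iInter_of_isOpen (fun i => isClosed_closure.isOpen_compl) fun i => ?_
  rw [← interior_eq_empty_iff_dense_compl, ← not_nonempty_iff_eq_empty]
  exact fun hne => hQ i ((Q i).eq_top_of_nonempty_interior' (hne.mono (interior_mono (hPQ i))))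

theorem IsHalfDiscExtension.exists_extendsBoundedly {v : ℝ → ℂ} {t a : ℝ} {G : ℂ → ℂ}
    (hG : IsHalfDiscExtension v t a G) (ha : 0 < a) :
    ∃ (q : ℚ) (n m : ℕ), ExtendsBoundedly v q (1 / (n + 1)) m := by
  obtain ⟨q, hq, hqa⟩ := exists_rat_btwn (show t < t + a / 2 by linarith)
  obtain ⟨n, hn⟩ := exists_nat_one_div_lt (half_pos ha)
  have hdist : dist (q : ℝ) t + a / 2 ≤ a := by
    rw [Real.dist_eq, abs_of_pos (by linarith)]
    linarith
  obtain ⟨M, hM⟩ := (hG.mono hdist).exists_norm_le hn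
  obtain ⟨m, hm⟩ := exists_nat_ge M
  have hle : dist (q : ℝ) q + 1 / (n + 1) ≤ a / 2 := by simpa using hn.le
  exact ⟨q, n, m, G, (hG.mono hdist).mono hle, fun w hw => (hM w hw).trans hm⟩

namespace Ck

variable {φ : ℂ → ℂ} {k : ℕ∞}

/-- The `u ∈ C^k(γ*)` whose composition with `g` extends to the half disc of centre `t` and radius
`a`. -/
def halfDiscExtendable (k : ℕ∞) (g : ℝ → trace φ) (t a : ℝ) : Submodule ℂ (Ck φ k) where
  carrier := {u | ∃ G, IsHalfDiscExtension (u.toFun ∘ g) t a G}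
  add_mem' := fun ⟨_, hG⟩ ⟨_, hG'⟩ => ⟨_, hG.add hG'⟩
  zero_mem' := ⟨0, continuousOn_const, differentiableOn_const 0, fun _ _ => rfl⟩
  smul_mem' := fun c _ ⟨_, hG⟩ => ⟨_, hG.const_smul c⟩

theorem closure_extendsBoundedly_subset {g : ℝ → trace φ} {t a M : ℝ} (ha : 0 < a) :
    closure {u : Ck φ k | ExtendsBoundedly (u.toFun ∘ g) t a M} ⊆
      halfDiscExtendable k g t (a / 10) := by
  intro u hu
  set P := {u : Ck φ k | ExtendsBoundedly (u.toFun ∘ g) t a M}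
  have := mem_closure_iff_comap_neBot.1 hu
  have hunif : TendstoUniformly (fun v : P => v.1.toFun) u.toFun (comap (↑) (𝓝 u)) :=
    tendstoUniformly_toFun tendsto_comap
  obtain ⟨G, hG, -⟩ := ExtendsBoundedly.of_tendstoUniformlyOn ha
    (hunif.comp g).tendstoUniformlyOn fun v => v.2
  exact ⟨G, hG⟩

theorem exists_eq_one_eventuallyEq_zero (k : ℕ∞) (e : Circle ≃ₜ trace φ)
    (he : ∀ θ : ℝ, e (Circle.exp θ) = ⟨boundaryCurve φ θ, mem_range_self θ⟩) {p q : trace φ}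
    (hpq : p ≠ q) : ∃ u : Ck φ k, u.toFun q = 1 ∧ u.toFun =ᶠ[𝓝 p] 0 := by
  have hd : 0 < dist (e.symm p : ℂ) (e.symm q) :=
    dist_pos.2 fun heq => hpq (e.symm.injective (Subtype.ext heq))
  let B : ContDiffBump (e.symm q : ℂ) := ⟨dist (e.symm p : ℂ) (e.symm q) / 4,
    dist (e.symm p : ℂ) (e.symm q) / 2, by positivity, by linarith⟩
  have hB : ContDiff ℝ k fun z => (B z : ℂ) := Complex.ofRealCLM.contDiff.comp B.contDiff
  have he_symm : Continuous fun z => (e.symm z : ℂ) :=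
    continuous_subtype_val.comp e.symm.continuous
  have hpull : pullback φ (fun z => (B (e.symm z) : ℂ)) =
      fun θ : ℝ => (B (Complex.exp (θ * Complex.I)) : ℂ) := by
    funext θ
    rw [pullback, ← he θ, e.symm_apply_apply, Circle.coe_exp]
  refine ⟨⟨fun z => (B (e.symm z) : ℂ), hB.continuous.comp he_symm, ?_⟩, ?_, ?_⟩
  · rw [hpull]
    exact hB.comp (Complex.ofRealCLM.contDiff.mul contDiff_const).cexp
  · exact congrArg Complex.ofReal
      (B.one_of_mem_closedBall (mem_closedBall_self B.rIn_pos.le))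
  · have hlt : B.rOut < dist (e.symm p : ℂ) (e.symm q) := half_lt_self hd
    filter_upwards [(he_symm.dist continuous_const).continuousAt.eventually (lt_mem_nhds hlt)]
      with z hz
    exact congrArg Complex.ofReal (B.zero_of_le_dist hz.le)

theorem halfDiscExtendable_ne_top {g : ℝ → trace φ} (hg : Continuous g) {s t a : ℝ}
    (hs : s ∈ ball t a) (hne : g s ≠ g t) (e : Circle ≃ₜ trace φ)
    (he : ∀ θ : ℝ, e (Circle.exp θ) = ⟨boundaryCurve φ θ, mem_range_self θ⟩) :
    halfDiscExtendable k g t a ≠ ⊤ := by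
  intro htop
  obtain ⟨u, hu_one, hu_zero⟩ := exists_eq_one_eventuallyEq_zero k e he hne
  obtain ⟨G, hG⟩ : u ∈ halfDiscExtendable k g t a := htop ▸ Submodule.mem_top
  have hut : u.toFun (g t) = 0 := hG.eqOn_zero hs (hg.continuousAt.eventually hu_zero)
    (mem_ball_self (pos_of_mem_ball hs))
  exact one_ne_zero (hu_one.symm.trans hut)

end Ck

namespace IsCollar

variable {φ : ℂ → ℂ} {k : ℕ∞} {S : Set ℂ} {Ψ : ℂ → ℂ} {r R : ℝ}

theorem setOf_not_extendsAt_eq_iInter (h : IsCollar (trace φ) S Ψ r R) (k : ℕ∞) :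
    {u : Ck φ k | ¬ ∃ z ∈ trace φ, ExtendsAt (trace φ) S u.toFun z} =
      ⋂ i : ℚ × ℕ × ℕ, (closure {u : Ck φ k |
        ExtendsBoundedly (u.toFun ∘ h.param) i.1 (1 / (i.2.1 + 1)) i.2.2})ᶜ := by
  refine Subset.antisymm (fun u hu => mem_iInter.2 fun i hi => ?_) ?_
  · obtain ⟨G, hG⟩ := Ck.closure_extendsBoundedly_subset Nat.one_div_pos_of_nat hi
    exact hu ⟨_, (h.param i.1).2, h.extendsAt u.continuous_toFun
      (div_pos Nat.one_div_pos_of_nat (by norm_num)) hG⟩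
  · rintro u hu ⟨z, hz, hext⟩
    obtain ⟨t, ht⟩ := h.surjective_param ⟨z, hz⟩
    obtain rfl : (h.param t : ℂ) = z := congrArg Subtype.val ht
    obtain ⟨a, ha, G, hG⟩ := h.exists_isHalfDiscExtension hext
    obtain ⟨q, n, m, hqnm⟩ := hG.exists_extendsBoundedly ha
    exact mem_iInter.1 hu (q, n, m) (subset_closure hqnm)

theorem isGδ_not_extendsAt (h : IsCollar (trace φ) S Ψ r R) (k : ℕ∞) :
    IsGδ {u : Ck φ k | ¬ ∃ z ∈ trace φ, ExtendsAt (trace φ) S u.toFun z} := by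
  rw [h.setOf_not_extendsAt_eq_iInter k]
  exact .iInter fun i => isClosed_closure.isOpen_compl.isGδ

theorem dense_not_extendsAt (h : IsCollar (trace φ) S Ψ r R) (k : ℕ∞) (e : Circle ≃ₜ trace φ)
    (he : ∀ θ : ℝ, e (Circle.exp θ) = ⟨boundaryCurve φ θ, mem_range_self θ⟩) :
    Dense {u : Ck φ k | ¬ ∃ z ∈ trace φ, ExtendsAt (trace φ) S u.toFun z} := by
  rw [h.setOf_not_extendsAt_eq_iInter k]
  refine dense_iInter_compl_closure _
    (fun i => Ck.closure_extendsBoundedly_subset Nat.one_div_pos_of_nat) fun i => ?_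
  obtain ⟨s, hs, hne⟩ := h.exists_param_ne i.1
    (div_pos (Nat.one_div_pos_of_nat (n := i.2.1)) (by norm_num : (0 : ℝ) < 10))
  exact Ck.halfDiscExtendable_ne_top h.continuous_param hs hne e he

end IsCollar

theorem IsAnalytic.exists_isAnnularChart {δ : ℝ → ℂ} (hδ : IsAnalytic δ) :
    ∃ Φ r R, IsAnnularChart (range δ) Φ r R := by
  obtain ⟨r, R, Φ, hr, hr1, hR, hd, hi, hδΦ⟩ := hδ
  refine ⟨Φ, r, R, hr, hr1, hR, hd, hi, ?_⟩
  rw [funext hδΦ]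
  exact ((Circle.exp_surjective.range_comp fun ζ : Circle => Φ ζ).trans
    ((range_comp Φ _).trans (congrArg (Φ '' ·) Subtype.range_coe))).symm

theorem IsAnalytic.exists_isCollar_trace {δ : ℝ → ℂ} (hδ : IsAnalytic δ) {φ : ℂ → ℂ}
    (hφ : IsRiemannMap φ (boundedSide (range δ))) :
    (∃ Ψ r R, IsCollar (trace φ) (boundedSide (trace φ)) Ψ r R) ∧
      (∃ Ψ r R, IsCollar (trace φ) (unboundedSide (trace φ)) Ψ r R) ∧
      ∃ e : Circle ≃ₜ trace φ,
        ∀ θ : ℝ, e (Circle.exp θ) = ⟨boundaryCurve φ θ, mem_range_self θ⟩ := by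
  obtain ⟨Φ, r, R, hΦ⟩ := hδ.exists_isAnnularChart
  have hb := isUnionOfComponents_boundedSide (range δ)
  have hu := isUnionOfComponents_unboundedSide (range δ)
  have hbu := disjoint_boundedSide_unboundedSide (range δ)
  have hb_ne : (boundedSide (range δ)).Nonempty :=
    ⟨φ 0, hφ.2.mapsTo (mem_ball_self one_pos)⟩
  have hu_ne := unboundedSide_nonempty hΦ.isCompact.isBounded
  obtain ⟨Ψ, r₁, R₁, hΨ⟩ := hΦ.exists_isCollar hb hu hbu hb_ne hu_ne
  have hfrontier : frontier (boundedSide (range δ)) = range δ :=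
    (hb.frontier_subset hΦ.isCompact.isClosed).antisymm hΨ.subset_frontier
  obtain ⟨htrace, he⟩ :=
    hφ.exists_circle_homeomorph (isBounded_boundedSide hΦ.isCompact.isBounded) hfrontier hΨ
  refine ⟨?_, ?_, he⟩ <;> rw [htrace]
  · exact ⟨Ψ, r₁, R₁, hΨ⟩
  · exact hΦ.exists_isCollar hu hb hbu.symm hu_ne hb_ne

end JordanCurve

theorem theorem4p27 (δ : ℝ → ℂ) (hδ : JordanCurve.IsAnalytic δ) (φ : ℂ → ℂ)
    (hφ : JordanCurve.IsRiemannMap φ (JordanCurve.boundedSide (Set.range δ))) (k : ℕ∞) :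
    (Dense (JordanCurve.U₂ φ k) ∧ IsGδ (JordanCurve.U₂ φ k)) ∧
    (Dense (JordanCurve.U₃ φ k) ∧ IsGδ (JordanCurve.U₃ φ k)) ∧
    (Dense (JordanCurve.U₄ φ k) ∧ IsGδ (JordanCurve.U₄ φ k)) := by
  obtain ⟨⟨_, _, _, hin⟩, ⟨_, _, _, hout⟩, e, he⟩ := hδ.exists_isCollar_trace hφ
  have hU₂ : Dense (JordanCurve.U₂ φ k) ∧ IsGδ (JordanCurve.U₂ φ k) :=
    ⟨hout.dense_not_extendsAt k e he, hout.isGδ_not_extendsAt k⟩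
  have hU₃ : Dense (JordanCurve.U₃ φ k) ∧ IsGδ (JordanCurve.U₃ φ k) :=
    ⟨hin.dense_not_extendsAt k e he, hin.isGδ_not_extendsAt k⟩
  exact ⟨hU₂, hU₃, hU₂.1.inter_of_Gδ hU₂.2 hU₃.2 hU₃.1, hU₂.2.inter hU₃.2⟩
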